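/- Let $\mathbb H$ be the upper half-plane and let $dV=\frac{3}{\pi}\frac{dx\,dy}{y^2}$ be the normalized hyperbolic measure on the modular domain $SL_2(\mathbb Z)\backslash\mathbb H$. For a nonzero cusp form $f$ of weight $k$ for $SL_2(\mathbb Z)$ let $$\nu(f)=\sum_{z\in SL_2(\mathbb Z)\backslash\mathbb H} w(z)\,\operatorname{ord}_z(f)$$ be the weighted number of inequivalent zeros of $f$ in $\mathbb H$, where $w(z)=1/\#\Gamma_z$ and $\Gamma_z$ is the stabilizer of $z$ in $\Gamma=SL_2(\mathbb Z)/\{\pm I\}$. Let $\{f_k\}$ be a sequence of cusp forms for $SL_2(\mathbb Z)$, with $f_k$ of weight $k$ and $k\to\infty$ along the sequence, which are $L^2$-normalized, $\int_{SL_2(\mathbb Z)\backslash\mathbb H} y^k|f_k(z)|^2\,dV(z)=1$, and for which the bulk of the zeros lie in the fundamental domain: $\nu(f_k)\sim k/12$. Assume that for some $c>0$ the measures $y^k|f_k(z)|^2\,dV(z)$ converge weakly to $c\cdot dV(z)$ when tested against continuous compactly supported functions on $SL_2(\mathbb Z)\backslash\mathbb H$, that is, for every such function $F$, $$\int_{SL_2(\mathbb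 Z)\backslash\mathbb H} F(z)\,y^k|f_k(z)|^2\,dV(z)\longrightarrow c\int_{SL_2(\mathbb Z)\backslash\mathbb H} F(z)\,dV(z).$$ Then the zeros of $f_k$ are equidistributed with respect to $dV$: for every compact $\Omega\subset SL_2(\mathbb Z)\backslash\mathbb H$ whose boundary has $dV$-measure zero, $$\frac{1}{\nu(f_k)}\sum_{z\in\Omega} w(z)\operatorname{ord}_z(f_k)\longrightarrow \int_\Omega dV ,$$ and for every continuous compactly supported function $F$ on $SL_2(\mathbb Z)\backslash\mathbb H$, $$\frac{1}{\nu(f_k)}\sum_{z\in SL_2(\mathbb Z)\backslash\mathbb H} w(z)\operatorname{ord}_z(f_k)\,F(z)\longrightarrow \int_{SL_2(\mathbb Z)\backslash\mathbb H} F\,dV .$$ -/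

import Mathlib

open Filter Topology MeasureTheory Asymptotics
open scoped MatrixGroups UpperHalfPlane

noncomputable section

namespace ModularZeros

/-- The modular domain `SL₂(ℤ) \ ℍ`, with the quotient topology and the quotient
measurable structure (which is the Borel structure). -/
abbrev ModularDomain : Type := MulAction.orbitRel.Quotient SL(2, ℤ) ℍ

/-- The canonical projection `ℍ → SL₂(ℤ) \ ℍ`. -/
def proj (z : ℍ) : ModularDomain := Quotient.mk _ z

/-- The normalized hyperbolic measure `dV = (3 / π) dx dy / y²` on `SL₂(ℤ) \ ℍ`: the image under
the projection of the (normalized) hyperbolic area on the standard fundamental domain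
`{|z| ≥ 1, |Re z| ≤ 1/2}`. The measure `volume` on `ℍ` is `dx dy / y²`. -/
def dV : Measure ModularDomain :=
  ENNReal.ofReal (3 / Real.pi) • ((volume : Measure ℍ).restrict ModularGroup.fd).map proj

/-- The stabilizer `Γ_z` of `z` in `Γ = SL₂(ℤ)/{±I}`; the center of `SL₂(ℤ)` is `{±I}`. -/
def stab (z : ℍ) : Subgroup (SL(2, ℤ) ⧸ Subgroup.center SL(2, ℤ)) :=
  (MulAction.stabilizer SL(2, ℤ) z).map (QuotientGroup.mk' (Subgroup.center SL(2, ℤ)))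

lemma card_stab_smul (g : SL(2, ℤ)) (z : ℍ) : Nat.card (stab (g • z)) = Nat.card (stab z) := by
  let q := QuotientGroup.mk' (Subgroup.center SL(2, ℤ))
  have h : stab (g • z) = (stab z).map (MulAut.conj (q g)).toMonoidHom := by
    unfold stab
    rw [MulAction.stabilizer_smul_eq_stabilizer_map_conj, Subgroup.map_map, Subgroup.map_map]
    rfl
  rw [h]
  exact Nat.card_congr
    ((stab z).equivMapOfInjective _ (MulAut.conj (q g)).injective).toEquiv.symm

/-- The weight `w(z) = 1 / #Γ_z`, as a function on `SL₂(ℤ) \ ℍ`. -/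
def w : ModularDomain → ℝ :=
  Quotient.lift (fun z : ℍ => 1 / (Nat.card (stab z) : ℝ)) (by
    rintro _ z ⟨g, rfl⟩
    simp only [card_stab_smul])

/-- The order of vanishing of the cusp form `f` at `z ∈ ℍ` (`UpperHalfPlane.ofComplex` is the local
inverse of the inclusion of `ℍ` into `ℂ`). -/
def ordAt {k : ℤ} (f : CuspForm 𝒮ℒ k) (z : ℍ) : ℕ :=
  analyticOrderNatAt (fun s : ℂ => f (UpperHalfPlane.ofComplex s)) (z : ℂ)

lemma slash_eq {k : ℤ} (f : CuspForm 𝒮ℒ k) (g : SL(2, ℤ)) (z : ℍ) :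
    f (g • z) = UpperHalfPlane.denom (Matrix.SpecialLinearGroup.mapGL ℝ g) z ^ k * f z :=
  SlashInvariantForm.slash_action_eqn'' f (MonoidHom.mem_range.mpr ⟨g, rfl⟩) z

lemma ordAt_smul {k : ℤ} (f : CuspForm 𝒮ℒ k) (g : SL(2, ℤ)) (z : ℍ) :
    ordAt f (g • z) = ordAt f z := by
  set G : GL (Fin 2) ℝ := Matrix.SpecialLinearGroup.mapGL ℝ g with hG
  have hdet : 0 < G.val.det := by
    have h : G.val.det = 1 :=
      congrArg Units.val (Matrix.SpecialLinearGroup.det_mapGL (S := ℝ) g)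
    rw [h]
    exact one_pos
  have hgz : g • z = G • z := rfl
  unfold ordAt analyticOrderNatAt
  congr 1
  have hf : AnalyticAt ℂ (fun s : ℂ => f (UpperHalfPlane.ofComplex s)) (z : ℂ) := by
    have := UpperHalfPlane.mdifferentiable_iff.mp f.holo'
    exact this.analyticAt (UpperHalfPlane.isOpen_upperHalfPlaneSet.mem_nhds z.im_pos)
  have hj : AnalyticAt ℂ (fun s : ℂ => UpperHalfPlane.denom G s ^ k) (z : ℂ) := by
    refine AnalyticAt.zpow ?_ (UpperHalfPlane.denom_ne_zero G z)
    unfold UpperHalfPlane.denom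
    fun_prop
  have h1 : analyticOrderAt ((fun s : ℂ => f (UpperHalfPlane.ofComplex s)) ∘
      (fun s : ℂ => ((G • UpperHalfPlane.ofComplex s : ℍ) : ℂ))) (z : ℂ) =
      analyticOrderAt (fun s : ℂ => f (UpperHalfPlane.ofComplex s)) ((g • z : ℍ) : ℂ) := by
    rw [analyticOrderAt_comp_of_deriv_ne_zero (z.analyticAt_smul hdet)
      (z.deriv_smul_ne_zero hdet)]
    simp [hgz]
  rw [← h1]
  have h2 : ((fun s : ℂ => f (UpperHalfPlane.ofComplex s)) ∘
      (fun s : ℂ => ((G • UpperHalfPlane.ofComplex s : ℍ) : ℂ))) =ᶠ[𝓝 (z : ℂ)]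
      (fun s : ℂ => UpperHalfPlane.denom G s ^ k) *
        (fun s : ℂ => f (UpperHalfPlane.ofComplex s)) := by
    filter_upwards [UpperHalfPlane.isOpen_upperHalfPlaneSet.mem_nhds z.im_pos] with s hs
    have := slash_eq f g ⟨s, hs⟩
    simp only [Function.comp_apply, Pi.mul_apply, UpperHalfPlane.ofComplex_apply,
      UpperHalfPlane.ofComplex_apply_of_im_pos hs]
    exact this
  rw [analyticOrderAt_congr h2, analyticOrderAt_mul hj hf,
    hj.analyticOrderAt_eq_zero.mpr (zpow_ne_zero _ (UpperHalfPlane.denom_ne_zero G z)), zero_add]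

/-- The order of vanishing of the cusp form `f`, as a function on `SL₂(ℤ) \ ℍ`. -/
def ord {k : ℤ} (f : CuspForm 𝒮ℒ k) : ModularDomain → ℕ :=
  Quotient.lift (ordAt f) (by
    rintro _ z ⟨g, rfl⟩
    exact ordAt_smul f g z)

/-- The weighted number `ν(f)` of inequivalent zeros of `f` in `ℍ`, counted with multiplicity.
A nonzero `f` has finitely many inequivalent zeros. -/
def ν {k : ℤ} (f : CuspForm 𝒮ℒ k) : ℝ := ∑ᶠ x : ModularDomain, w x * ord f x

lemma mass_smul {k : ℤ} (f : CuspForm 𝒮ℒ k) (g : SL(2, ℤ)) (z : ℍ) :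
    (g • z).im ^ k * ‖f (g • z)‖ ^ 2 = z.im ^ k * ‖f z‖ ^ 2 := by
  have h (z : ℍ) : ‖UpperHalfPlane.petersson k f f z‖ = z.im ^ k * ‖f z‖ ^ 2 := by
    simp only [UpperHalfPlane.petersson, norm_mul, RCLike.norm_conj, norm_zpow,
      Complex.norm_real, Real.norm_of_nonneg z.im_pos.le]
    ring
  rw [← h, ← h]
  exact SlashInvariantFormClass.norm_petersson_smul
    (g := Matrix.SpecialLinearGroup.mapGL ℝ g) (MonoidHom.mem_range.mpr ⟨g, rfl⟩)

/-- The mass density `y^k |f(z)|²`, as a function on `SL₂(ℤ) \ ℍ`. -/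
def mass {k : ℤ} (f : CuspForm 𝒮ℒ k) : ModularDomain → ℝ :=
  Quotient.lift (fun z : ℍ => z.im ^ k * ‖f z‖ ^ 2) (by
    rintro _ z ⟨g, rfl⟩
    exact mass_smul f g z)

/-- `f` is `L²`-normalized: `∫ y^k |f|² dV = 1` over `SL₂(ℤ) \ ℍ`. -/
def L2Normalized {k : ℤ} (f : CuspForm 𝒮ℒ k) : Prop := ∫ x, mass f x ∂dV = 1

/-- Weak convergence `y^k |f_k|² dV → c dV`, tested against continuous compactly supported
functions on `SL₂(ℤ) \ ℍ`. -/
def MassConvergesWeakly {k : ℕ → ℤ} (f : ∀ n, CuspForm 𝒮ℒ (k n)) (c : ℝ) : Prop :=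
  ∀ F : ModularDomain → ℝ, Continuous F → HasCompactSupport F →
    Tendsto (fun n => ∫ x, F x * mass (f n) x ∂dV) atTop (𝓝 (c * ∫ x, F x ∂dV))

/-- The zeros of `f_n` become equidistributed with respect to `dV`: the weighted proportion of
inequivalent zeros that lie in a compact set `Ω` with `dV`-null boundary tends to the area of `Ω`,
and the weighted averages over the zeros of every continuous compactly supported function tend to
its integral. -/
structure ZerosEquidistributed {k : ℕ → ℤ} (f : ∀ n, CuspForm 𝒮ℒ (k n)) : Prop where
  sets : ∀ Ω : Set ModularDomain, IsCompact Ω → dV (frontier Ω) = 0 →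
    Tendsto (fun n => 1 / ν (f n) * ∑ᶠ x ∈ Ω, w x * ord (f n) x) atTop (𝓝 (dV.real Ω))
  functions : ∀ F : ModularDomain → ℝ, Continuous F → HasCompactSupport F →
    Tendsto (fun n => 1 / ν (f n) * ∑ᶠ x, w x * ord (f n) x * F x) atTop (𝓝 (∫ x, F x ∂dV))

end ModularZeros

end

/-!
Put `u_n = (2 / k_n) log |f_n|`. Away from the zeros of `f_n` this function is harmonic, and its
Laplacian is `4π / k_n` times the zero counting measure. The proof is that `u_n → -log y` in
`L¹_loc` in the interior of the standard fundamental domain, and that `Δ (-log y) = 1 / y²` is the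
density of hyperbolic area.

*Upper bound for `u_n`.* The sub-mean value property of `|f_n|²` and the `L²`-normalization give
`u_n ≤ -log y + ε` on compact sets, for large `n` (`eventually_norm_sq_le_exp`).

*Near equality at some points.* If `u_n` were smaller than `-log y - ε` on a whole disc, the mass of
`f_n` on that disc would decay exponentially, against the weak convergence to `c dV` with `c > 0`
(`eventually_exists_exp_le_norm_sq`). The two bounds together form the hypothesis
`AsymptoticallyExtremal`, from which the distribution of the zeros follows by potential theory
alone.

*Potential theory.* Since `log |f_n|` is subharmonic, while `-log y` differs from its averages over
circles of radius `ρ` only by `O(ρ²)`, near equality at one point makes the average of the deficit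
`ε - log y - u_n ≥ 0` over a disc about that point of order `ε + ρ²`. Covering a fixed disc by
`N²` discs of radius comparable to `1 / N` bounds the integral of the deficit by an arbitrarily
small constant (`AsymptoticallyExtremal.eventually_lintegral_deficit_lt`). Hence the circle averages
of `u_n` and of `-log y` are close on a circle of suitable radius. Jensen's formula for two
concentric circles bounds the number of zeros from below by the growth of these averages
(`circleAverage_sub_le_sum_order`), and the growth of the averages of `-log y` is explicit
(`circleAverage_log_im_sub`). This gives the expected lower bound for the number of zeros in a disc
(`AsymptoticallyExtremal.eventually_le_sum_order`), and a Besicovitch packing by disjoint discs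
extends it to open sets (`AsymptoticallyExtremal.eventually_le_sum_order_of_isOpen`).

*From lower bounds to equidistribution.* With `ν(f_n) ~ k_n / 12`, the normalized zero counting
measures and `dV` are all probability measures, and the lower bound becomes
`dV G ≤ liminf m_n G` for every open `G` (`dV_le_liminf_zeroMeasure`). The total masses being equal,
no proportion of the zeros can be lost to the cusp or gather on the boundary of the fundamental
domain, and the portmanteau theorem yields weak convergence. In particular no analysis is needed
near the elliptic points, the boundary or the cusp.
-/

namespace ModularZeros

open Set Metric Real
open scoped ENNReal

/-! ### Circle averages and area integrals in polar coordinates -/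

lemma lintegral_eq_lintegral_circleMap (c : ℂ) {g : ℂ → ℝ≥0∞} (hg : Measurable g) :
    ∫⁻ z, g z = ∫⁻ r in Ioi (0 : ℝ), ENNReal.ofReal r *
      ∫⁻ θ in Ioo (-π) π, g (circleMap c r θ) := by
  rw [← lintegral_add_right_eq_self g c, ← Complex.lintegral_comp_polarCoord_symm,
    show polarCoord.target = Ioi (0 : ℝ) ×ˢ Ioo (-π) π from rfl,
    Measure.volume_eq_prod, ← Measure.prod_restrict]
  have hm : Measurable fun p : ℝ × ℝ => circleMap c p.1 p.2 := by
    unfold circleMap; fun_prop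
  have heq : ∀ p : ℝ × ℝ, ENNReal.ofReal p.1 • g (Complex.polarCoord.symm p + c) =
      ENNReal.ofReal p.1 * g (circleMap c p.1 p.2) := by
    intro p
    have : (Complex.polarCoord.symm p : ℂ) + c = circleMap c p.1 p.2 := by
      simp [circleMap, Complex.exp_mul_I, add_comm]
    rw [this, smul_eq_mul]
  simp_rw [heq]
  rw [lintegral_prod _ (by fun_prop)]
  refine lintegral_congr fun r => ?_
  have hθ : Measurable fun θ => g (circleMap c r θ) :=
    hg.comp (hm.comp measurable_prodMk_left)
  exact lintegral_const_mul (μ := volume.restrict (Ioo (-π) π)) (ENNReal.ofReal r) hθ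

lemma setLIntegral_ball_eq (c : ℂ) (R : ℝ) {g : ℂ → ℝ≥0∞} (hg : Measurable g) :
    ∫⁻ z in ball c R, g z = ∫⁻ r in Ioo (0 : ℝ) R, ENNReal.ofReal r *
      ∫⁻ θ in Ioo (-π) π, g (circleMap c r θ) := by
  rw [← lintegral_indicator measurableSet_ball,
    lintegral_eq_lintegral_circleMap c (hg.indicator measurableSet_ball),
    ← lintegral_indicator measurableSet_Ioi, ← lintegral_indicator measurableSet_Ioo]
  refine lintegral_congr fun r => ?_
  by_cases h0 : 0 < r
  · have hmem (θ : ℝ) : circleMap c r θ ∈ ball c R ↔ r < R := by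
      simp [circleMap, abs_of_pos h0]
    by_cases hR : r < R
    · simp [indicator, h0, hR, hmem]
    · simp [indicator, h0, hR, hmem]
  · simp [indicator, h0]

lemma lintegral_ofReal_Ioo {R : ℝ} (hR : 0 ≤ R) :
    ∫⁻ r in Ioo (0 : ℝ) R, ENNReal.ofReal r = ENNReal.ofReal (R ^ 2 / 2) := by
  rw [← ofReal_integral_eq_lintegral_ofReal]
  · rw [← integral_Ioc_eq_integral_Ioo, ← intervalIntegral.integral_of_le hR, integral_id]
    norm_num
  · exact (continuous_id.integrableOn_Icc (a := (0 : ℝ)) (b := R)).mono_set Ioo_subset_Icc_self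
  · filter_upwards [ae_restrict_mem measurableSet_Ioo] with r hr using hr.1.le

/-- A bound for the integrals over concentric circles gives a bound for the area integral. -/
lemma setLIntegral_ball_le {c : ℂ} {R A : ℝ} (hR : 0 ≤ R) {g : ℂ → ℝ≥0∞} (hg : Measurable g)
    (h : ∀ r ∈ Ioo 0 R, ∫⁻ θ in Ioo (-π) π, g (circleMap c r θ) ≤ ENNReal.ofReal (2 * π * A)) :
    ∫⁻ z in ball c R, g z ≤ ENNReal.ofReal (π * R ^ 2 * A) := by
  rw [setLIntegral_ball_eq c R hg]
  calc _ ≤ ∫⁻ r in Ioo (0 : ℝ) R, ENNReal.ofReal r * ENNReal.ofReal (2 * π * A) := by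
        refine setLIntegral_mono (by fun_prop) fun r hr => ?_
        gcongr
        exact h r hr
    _ = ENNReal.ofReal (R ^ 2 / 2) * ENNReal.ofReal (2 * π * A) := by
        rw [lintegral_mul_const _ (by fun_prop), lintegral_ofReal_Ioo hR]
    _ = _ := by
        rw [← ENNReal.ofReal_mul (by positivity)]
        congr 1
        ring

lemma le_setLIntegral_ball {c : ℂ} {R A : ℝ} (hR : 0 ≤ R) {g : ℂ → ℝ≥0∞} (hg : Measurable g)
    (h : ∀ r ∈ Ioo 0 R, ENNReal.ofReal (2 * π * A) ≤ ∫⁻ θ in Ioo (-π) π, g (circleMap c r θ)) :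
    ENNReal.ofReal (π * R ^ 2 * A) ≤ ∫⁻ z in ball c R, g z := by
  rw [setLIntegral_ball_eq c R hg]
  calc ENNReal.ofReal (π * R ^ 2 * A)
      = ENNReal.ofReal (R ^ 2 / 2) * ENNReal.ofReal (2 * π * A) := by
        rw [← ENNReal.ofReal_mul (by positivity)]
        congr 1
        ring
    _ = ∫⁻ r in Ioo (0 : ℝ) R, ENNReal.ofReal r * ENNReal.ofReal (2 * π * A) := by
        rw [lintegral_mul_const _ (by fun_prop), lintegral_ofReal_Ioo hR]
    _ ≤ _ := by
        refine setLIntegral_mono' measurableSet_Ioo fun r hr => ?_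
        gcongr
        exact h r hr

/-- If the area integral over a disc is small, then so is the integral over some circle in a given
annulus. -/
lemma exists_circle_lintegral_le {c : ℂ} {ρ R A : ℝ} (hρ : 0 < ρ) (hA : 0 < A)
    {g : ℂ → ℝ≥0∞} (hg : Measurable g)
    (h : ∫⁻ z in ball c R, g z < ENNReal.ofReal (ρ * (R - ρ) * A)) :
    ∃ s ∈ Ioo ρ R, ∫⁻ θ in Ioo (-π) π, g (circleMap c s θ) ≤ ENNReal.ofReal A := by
  by_contra! hcon
  refine h.not_ge ?_
  rw [setLIntegral_ball_eq c R hg]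
  calc ENNReal.ofReal (ρ * (R - ρ) * A)
      = ∫⁻ r in Ioo ρ R, ENNReal.ofReal ρ * ENNReal.ofReal A := by
        rw [setLIntegral_const, Real.volume_Ioo, ← ENNReal.ofReal_mul hρ.le,
          ← ENNReal.ofReal_mul (by positivity)]
        congr 1
        ring
    _ ≤ ∫⁻ r in Ioo ρ R, ENNReal.ofReal r * ∫⁻ θ in Ioo (-π) π, g (circleMap c r θ) := by
        refine setLIntegral_mono' measurableSet_Ioo fun r hr => ?_
        gcongr
        · exact hr.1.le
        · exact (hcon r hr).le
    _ ≤ _ := lintegral_mono_set (Ioo_subset_Ioo_left hρ.le)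

lemma circleAverage_eq_setIntegral (f : ℂ → ℝ) (c : ℂ) (R : ℝ) :
    circleAverage f c R = (2 * π)⁻¹ * ∫ θ in Ioo (-π) π, f (circleMap c R θ) := by
  rw [circleAverage_eq_integral_add (-π), smul_eq_mul, intervalIntegral.integral_comp_add_right
    (fun θ => f (circleMap c R θ)), zero_add, show 2 * π + -π = π by ring,
    intervalIntegral.integral_of_le (by linarith [pi_pos]), integral_Ioc_eq_integral_Ioo]

lemma setIntegral_circle_eq (f : ℂ → ℝ) (c : ℂ) (R : ℝ) :
    ∫ θ in Ioo (-π) π, f (circleMap c R θ) = 2 * π * circleAverage f c R := by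
  rw [circleAverage_eq_setIntegral, mul_inv_cancel_left₀ (by positivity)]

lemma integrableOn_circle {f : ℂ → ℝ} {c : ℂ} {R : ℝ} (hf : CircleIntegrable f c R) :
    IntegrableOn (fun θ => f (circleMap c R θ)) (Ioo (-π) π) := by
  have hp : Function.Periodic (fun θ => f (circleMap c R θ)) (2 * π) :=
    fun θ => by simp [periodic_circleMap c R θ]
  have := hp.intervalIntegrable (t := 0) (by positivity) (by rw [zero_add]; exact hf) (-π) π
  rw [intervalIntegrable_iff_integrableOn_Ioo_of_le (by linarith [pi_pos])] at this
  exact this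

lemma lintegral_circle_eq {f : ℂ → ℝ} {c : ℂ} {R : ℝ} (hf : CircleIntegrable f c R)
    (h0 : ∀ᵐ θ, 0 ≤ f (circleMap c R θ)) :
    ∫⁻ θ in Ioo (-π) π, ENNReal.ofReal (f (circleMap c R θ)) =
      ENNReal.ofReal (2 * π * circleAverage f c R) := by
  rw [← ofReal_integral_eq_lintegral_ofReal (integrableOn_circle hf) (ae_restrict_of_ae h0),
    setIntegral_circle_eq]

lemma circleAverage_le_of_lintegral_le {f : ℂ → ℝ} {c : ℂ} {R A : ℝ} (hA : 0 ≤ A)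
    (hf : CircleIntegrable f c R)
    (h : ∫⁻ θ in Ioo (-π) π, ENNReal.ofReal (f (circleMap c R θ)) ≤
      ENNReal.ofReal (2 * π * A)) :
    circleAverage f c R ≤ A := by
  have h1 := integral_eq_lintegral_pos_part_sub_lintegral_neg_part (integrableOn_circle hf)
  have h2 := ENNReal.toReal_mono ENNReal.ofReal_ne_top h
  rw [ENNReal.toReal_ofReal (by positivity)] at h2
  rw [setIntegral_circle_eq] at h1
  have h3 : 2 * π * circleAverage f c R ≤ 2 * π * A := by
    rw [h1]
    linarith [ENNReal.toReal_nonneg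
      (a := ∫⁻ θ in Ioo (-π) π, ENNReal.ofReal (-f (circleMap c R θ)))]
  exact le_of_mul_le_mul_left h3 (by positivity)

lemma circleAverage_mono_ae {f₁ f₂ : ℂ → ℝ} {c : ℂ} {R : ℝ} (h₁ : CircleIntegrable f₁ c R)
    (h₂ : CircleIntegrable f₂ c R) (h : ∀ᵐ θ, f₁ (circleMap c R θ) ≤ f₂ (circleMap c R θ)) :
    circleAverage f₁ c R ≤ circleAverage f₂ c R := by
  rw [circleAverage_eq_setIntegral, circleAverage_eq_setIntegral]
  have := setIntegral_mono_ae (integrableOn_circle h₁) (integrableOn_circle h₂) h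
  gcongr

/-! ### Consequences of Jensen's formula -/

lemma divisor_eq_natCast {g : ℂ → ℂ} {U : Set ℂ} (hg : AnalyticOnNhd ℂ g U) {u : ℂ} (hu : u ∈ U) :
    MeromorphicOn.divisor g U u = (analyticOrderNatAt g u : ℤ) := by
  rw [MeromorphicOn.AnalyticOnNhd.divisor_apply hg hu]
  unfold analyticOrderNatAt
  cases analyticOrderAt g u <;> simp

lemma circleIntegrable_log_norm {g : ℂ → ℂ} {c : ℂ} {r : ℝ} (hr : 0 ≤ r)
    (hg : AnalyticOnNhd ℂ g (closedBall c r)) :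
    CircleIntegrable (fun z => log ‖g z‖) c r :=
  MeromorphicOn.circleIntegrable_log_norm_of_nonneg
    (fun z hz => (hg z (sphere_subset_closedBall hz)).meromorphicAt) hr

open Classical in
/-- Jensen's formula, with the zeros of an analytic function counted by `analyticOrderNatAt`. -/
lemma jensen {g : ℂ → ℂ} {c : ℂ} {r s : ℝ} (hr : 0 < r) (hrs : r ≤ s)
    (hg : AnalyticOnNhd ℂ g (closedBall c s)) {T : Finset ℂ} (hc : c ∈ T)
    (hT : Function.support (MeromorphicOn.divisor g (closedBall c s)) ⊆ T) :
    circleAverage (fun z => log ‖g z‖) c r =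
      ∑ u ∈ T, (if u ∈ closedBall c r then (analyticOrderNatAt g u : ℝ) *
        (if u = c then log r else log (r * ‖c - u‖⁻¹)) else 0) +
      log ‖meromorphicTrailingCoeffAt g c‖ := by
  have hsub : closedBall c r ⊆ closedBall c s := closedBall_subset_closedBall hrs
  have hgr := hg.mono hsub
  have habs : |r| = r := abs_of_pos hr
  have hz : ∀ u ∉ T, MeromorphicOn.divisor g (closedBall c r) u = 0 := by
    intro u hu
    by_cases hur : u ∈ closedBall c r
    · have h1 : MeromorphicOn.divisor g (closedBall c s) u = 0 := by
        by_contra h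
        exact hu (hT h)
      rw [divisor_eq_natCast hg (hsub hur)] at h1
      rw [divisor_eq_natCast hgr hur, h1]
    · exact Function.locallyFinsuppWithin.apply_eq_zero_of_notMem _ hur
  have hJ := MeromorphicOn.circleAverage_log_norm hr.ne' (f := g) (c := c)
    (by rw [habs]; exact hgr.meromorphicOn)
  rw [habs] at hJ
  rw [hJ, finsum_eq_sum_of_support_subset (s := T)]
  · have hsum : ∑ u ∈ T, (if u ∈ closedBall c r then (analyticOrderNatAt g u : ℝ) *
        (if u = c then log r else log (r * ‖c - u‖⁻¹)) else 0) =
        ∑ u ∈ T, ((MeromorphicOn.divisor g (closedBall c r) u : ℝ) * log (r * ‖c - u‖⁻¹) +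
          if u = c then (MeromorphicOn.divisor g (closedBall c r) c : ℝ) * log r else 0) := by
      refine Finset.sum_congr rfl fun u _ => ?_
      by_cases hur : u ∈ closedBall c r
      · rw [divisor_eq_natCast hgr hur]
        by_cases huc : u = c
        · subst huc
          rw [divisor_eq_natCast hgr hur]
          simp [hr.le]
        · simp [huc, -mem_closedBall, hur]
      · rw [Function.locallyFinsuppWithin.apply_eq_zero_of_notMem _ hur]
        have huc : u ≠ c := by
          rintro rfl
          exact hur (mem_closedBall_self hr.le)
        simp [huc, -mem_closedBall, hur]
    rw [hsum, Finset.sum_add_distrib, Finset.sum_ite_eq' T c, if_pos hc]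
  · intro u hu
    by_contra h
    exact hu (by simp [hz u h])

/-- `log ‖g‖` is subharmonic. -/
lemma log_norm_le_circleAverage {g : ℂ → ℂ} {c : ℂ} {r : ℝ} (hr : 0 < r)
    (hg : AnalyticOnNhd ℂ g (closedBall c r)) (hc : g c ≠ 0) :
    log ‖g c‖ ≤ circleAverage (fun z => log ‖g z‖) c r := by
  classical
  have hfin := (MeromorphicOn.divisor g (closedBall c r)).finiteSupport (isCompact_closedBall c r)
  rw [jensen hr le_rfl hg (T := insert c hfin.toFinset) (by simp)
    (by intro u hu; simpa using Or.inr hu),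
    (hg c (mem_closedBall_self hr.le)).meromorphicTrailingCoeffAt_of_ne_zero hc]
  refine le_add_of_nonneg_left (Finset.sum_nonneg fun u _ => ?_)
  split_ifs with h1 h2
  · have h0 : analyticOrderNatAt g u = 0 := by
      unfold analyticOrderNatAt
      rw [h2, (hg c (mem_closedBall_self hr.le)).analyticOrderAt_eq_zero.mpr hc]
      rfl
    simp [h0]
  · refine mul_nonneg (by positivity) (log_nonneg ?_)
    have h3 : 0 < ‖c - u‖ := norm_pos_iff.mpr (sub_ne_zero.mpr (Ne.symm h2))
    rw [← div_eq_mul_inv, one_le_div h3]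
    rwa [mem_closedBall, dist_comm, dist_eq_norm] at h1
  · exact le_rfl

/-- The growth of the circle averages of `log ‖g‖` bounds the number of zeros of `g` from below. -/
lemma circleAverage_sub_le_sum_order {g : ℂ → ℂ} {c : ℂ} {r s : ℝ} (hr : 0 < r) (hrs : r ≤ s)
    (hg : AnalyticOnNhd ℂ g (closedBall c s)) :
    ∃ T : Finset ℂ, (T : Set ℂ) ⊆ closedBall c s ∧
      circleAverage (fun z => log ‖g z‖) c s - circleAverage (fun z => log ‖g z‖) c r ≤
        (∑ u ∈ T, (analyticOrderNatAt g u : ℝ)) * log (s / r) := by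
  classical
  have hs := hr.trans_le hrs
  have hfin := (MeromorphicOn.divisor g (closedBall c s)).finiteSupport (isCompact_closedBall c s)
  have hT : Function.support (MeromorphicOn.divisor g (closedBall c s)) ⊆
      (insert c hfin.toFinset : Finset ℂ) := by
    intro u hu
    simpa using Or.inr hu
  have hTs : ((insert c hfin.toFinset : Finset ℂ) : Set ℂ) ⊆ closedBall c s := by
    intro u hu
    simp only [Finset.coe_insert, Finite.coe_toFinset, mem_insert_iff] at hu
    rcases hu with rfl | hu
    · exact mem_closedBall_self hs.le
    · exact (MeromorphicOn.divisor g (closedBall c s)).supportWithinDomain hu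
  refine ⟨insert c hfin.toFinset, hTs, ?_⟩
  rw [jensen hr hrs hg (by simp) hT, jensen hs le_rfl hg (by simp) hT, add_sub_add_right_eq_sub,
    ← Finset.sum_sub_distrib, Finset.sum_mul]
  refine Finset.sum_le_sum fun u hu => ?_
  rw [if_pos (hTs hu)]
  by_cases huc : u = c
  · subst huc
    rw [if_pos (mem_closedBall_self hr.le), if_pos rfl, if_pos rfl, log_div hs.ne' hr.ne', mul_sub]
  · have h3 : 0 < ‖c - u‖ := norm_pos_iff.mpr (sub_ne_zero.mpr (Ne.symm huc))
    rw [if_neg huc, if_neg huc, log_mul hs.ne' (by positivity), log_mul hr.ne' (by positivity),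
      log_div hs.ne' hr.ne', log_inv]
    split_ifs with h
    -- A zero `u` with `‖c - u‖ ≤ r` adds exactly `log (s / r)` times its order.
    · exact le_of_eq (by ring)
    -- A zero with `r < ‖c - u‖ ≤ s` adds `log (s / ‖c - u‖)` times its order, which is less.
    · have h4 : r < ‖c - u‖ := by
        rwa [mem_closedBall, dist_comm, dist_eq_norm, not_le] at h
      have := log_lt_log hr h4
      rw [sub_zero]
      gcongr
      linarith

/-! ### Circle averages of the logarithm of the imaginary part -/

lemma im_circleMap (c : ℂ) (s θ : ℝ) : (circleMap c s θ).im = c.im + s * sin θ := by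
  simp [circleMap, Complex.exp_im]

lemma im_pos_of_mem_closedBall {c z : ℂ} {s : ℝ} (hs : s < c.im) (hz : z ∈ closedBall c s) :
    0 < z.im := by
  rw [mem_closedBall, dist_eq_norm] at hz
  have h1 := Complex.abs_im_le_norm (z - c)
  rw [Complex.sub_im, abs_le] at h1
  linarith

lemma continuousOn_log_im {c : ℂ} {s : ℝ} (hs : s < c.im) :
    ContinuousOn (fun z : ℂ => log z.im) (closedBall c s) :=
  Complex.continuous_im.continuousOn.log fun _ hz => (im_pos_of_mem_closedBall hs hz).ne'

lemma circleIntegrable_log_im {c : ℂ} {s : ℝ} (h0 : 0 ≤ s) (hs : s < c.im) :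
    CircleIntegrable (fun z : ℂ => log z.im) c s :=
  ((continuousOn_log_im hs).mono sphere_subset_closedBall).circleIntegrable h0

lemma sq_sin_lt {y s : ℝ} (h0 : 0 ≤ s) (hs : s < y) (θ : ℝ) : 0 < y ^ 2 - s ^ 2 * sin θ ^ 2 := by
  nlinarith [sin_sq_le_one θ, sq_nonneg s]

lemma continuous_log_sq_sub {y s : ℝ} (h0 : 0 ≤ s) (hs : s < y) :
    Continuous fun θ : ℝ => log (y ^ 2 - s ^ 2 * sin θ ^ 2) :=
  Continuous.log (by fun_prop) fun θ => (sq_sin_lt h0 hs θ).ne'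

/-- Reflecting the circle in the horizontal line through its centre `c` pairs the points with
imaginary parts `c.im ± s * sin θ`. -/
lemma circleAverage_log_im {c : ℂ} {s : ℝ} (h0 : 0 ≤ s) (hs : s < c.im) :
    circleAverage (fun z => log z.im) c s =
      (4 * π)⁻¹ * ∫ θ in (-π)..π, log (c.im ^ 2 - s ^ 2 * sin θ ^ 2) := by
  have hle : -π ≤ π := by linarith [pi_pos]
  rw [circleAverage_eq_setIntegral, ← integral_Ioc_eq_integral_Ioo,
    ← intervalIntegral.integral_of_le hle]
  simp_rw [im_circleMap]
  have hpos (θ : ℝ) : 0 < c.im + s * sin θ := by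
    nlinarith [neg_one_le_sin θ]
  have hc : Continuous fun θ : ℝ => log (c.im + s * sin θ) :=
    Continuous.log (by fun_prop) fun θ => (hpos θ).ne'
  have hc' : Continuous fun θ : ℝ => log (c.im + s * sin (-θ)) := hc.comp continuous_neg
  have h1 : ∫ θ in (-π)..π, log (c.im + s * sin (-θ)) = ∫ θ in (-π)..π, log (c.im + s * sin θ) := by
    rw [intervalIntegral.integral_comp_neg (fun θ => log (c.im + s * sin θ)), neg_neg]
  have h2 : ∫ θ in (-π)..π, log (c.im ^ 2 - s ^ 2 * sin θ ^ 2) =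
      (∫ θ in (-π)..π, log (c.im + s * sin θ)) + ∫ θ in (-π)..π, log (c.im + s * sin (-θ)) := by
    rw [← intervalIntegral.integral_add (hc.intervalIntegrable _ _) (hc'.intervalIntegrable _ _)]
    refine intervalIntegral.integral_congr fun θ _ => ?_
    have h3 := hpos (-θ)
    rw [← log_mul (hpos θ).ne' h3.ne', sin_neg]
    congr 1
    ring
  rw [h2, h1]
  field_simp
  ring

lemma log_im_sub_le_circleAverage {c : ℂ} {s : ℝ} (h0 : 0 ≤ s) (hs : s ≤ c.im / 2)
    (hc : 0 < c.im) :
    log c.im - s ^ 2 / c.im ^ 2 ≤ circleAverage (fun z => log z.im) c s := by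
  have hs' : s < c.im := by linarith
  rw [circleAverage_log_im h0 hs']
  have hle : -π ≤ π := by linarith [pi_pos]
  have key : ∫ _ in (-π)..π, (2 * log c.im - 2 * (s ^ 2 / c.im ^ 2)) ≤
      ∫ θ in (-π)..π, log (c.im ^ 2 - s ^ 2 * sin θ ^ 2) := by
    refine intervalIntegral.integral_mono_on hle (by simp)
      ((continuous_log_sq_sub h0 hs').intervalIntegrable _ _) fun θ _ => ?_
    have ht : s ^ 2 / c.im ^ 2 ≤ 1 / 4 := by
      rw [div_le_iff₀ (by positivity)]
      nlinarith
    set t := s ^ 2 / c.im ^ 2 with htdef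
    have ht0 : 0 ≤ t := by positivity
    have hst : s ^ 2 = t * c.im ^ 2 := by rw [htdef]; field_simp
    have h1 : c.im ^ 2 * (1 - t) ≤ c.im ^ 2 - s ^ 2 * sin θ ^ 2 := by
      nlinarith [sin_sq_le_one θ, sq_nonneg s]
    have h2 : -(2 * t) ≤ log (1 - t) := by
      have h3 := one_sub_inv_le_log_of_pos (show 0 < 1 - t by linarith)
      have h4 : (1 - t)⁻¹ ≤ 1 + 2 * t := by
        rw [inv_le_iff_one_le_mul₀ (by linarith)]
        nlinarith
      linarith
    have h5 := log_le_log (mul_pos (by positivity) (by linarith)) h1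
    rw [log_mul (by positivity) (by linarith), log_pow] at h5
    push_cast at h5
    linarith
  rw [intervalIntegral.integral_const, smul_eq_mul] at key
  calc _ = (4 * π)⁻¹ * ((π - -π) * (2 * log c.im - 2 * (s ^ 2 / c.im ^ 2))) := by
        field_simp
        ring
    _ ≤ _ := by gcongr

lemma circleAverage_log_im_sub {c : ℂ} {r s : ℝ} (h0 : 0 ≤ r) (hrs : r ≤ s) (hs : s < c.im) :
    (s ^ 2 - r ^ 2) / (4 * c.im ^ 2) ≤
      circleAverage (fun z => log z.im) c r - circleAverage (fun z => log z.im) c s := by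
  have hs0 := h0.trans hrs
  have hc : 0 < c.im := by linarith
  have hr : r < c.im := by linarith
  rw [circleAverage_log_im h0 hr, circleAverage_log_im hs0 hs, ← mul_sub,
    ← intervalIntegral.integral_sub ((continuous_log_sq_sub h0 hr).intervalIntegrable _ _)
      ((continuous_log_sq_sub hs0 hs).intervalIntegrable _ _)]
  have hle : -π ≤ π := by linarith [pi_pos]
  have key : ∫ θ in (-π)..π, (s ^ 2 - r ^ 2) / c.im ^ 2 * sin θ ^ 2 ≤
      ∫ θ in (-π)..π, (log (c.im ^ 2 - r ^ 2 * sin θ ^ 2) -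
        log (c.im ^ 2 - s ^ 2 * sin θ ^ 2)) := by
    refine intervalIntegral.integral_mono_on hle
      (Continuous.intervalIntegrable (by fun_prop) _ _)
      (((continuous_log_sq_sub h0 hr).sub (continuous_log_sq_sub hs0 hs)).intervalIntegrable _ _)
      fun θ _ => ?_
    have ha := sq_sin_lt h0 hr θ
    have hb := sq_sin_lt hs0 hs θ
    -- `1 - 1 / x ≤ log x` at the quotient of the two arguments of the logarithm.
    have h1 := one_sub_inv_le_log_of_pos (div_pos ha hb)
    rw [log_div ha.ne' hb.ne', inv_div] at h1
    refine le_trans ?_ h1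
    have h2 : 1 - (c.im ^ 2 - s ^ 2 * sin θ ^ 2) / (c.im ^ 2 - r ^ 2 * sin θ ^ 2) =
        ((s ^ 2 - r ^ 2) * sin θ ^ 2) / (c.im ^ 2 - r ^ 2 * sin θ ^ 2) := by
      rw [eq_div_iff ha.ne', sub_mul, div_mul_cancel₀ _ ha.ne']
      ring
    rw [h2, div_mul_eq_mul_div]
    have h3 : 0 ≤ (s ^ 2 - r ^ 2) * sin θ ^ 2 :=
      mul_nonneg (by nlinarith) (sq_nonneg _)
    gcongr
    nlinarith [mul_nonneg (sq_nonneg r) (sq_nonneg (sin θ))]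
  have hsin : ∫ θ in (-π)..π, (s ^ 2 - r ^ 2) / c.im ^ 2 * sin θ ^ 2 =
      (s ^ 2 - r ^ 2) / c.im ^ 2 * π := by
    rw [intervalIntegral.integral_const_mul, integral_sin_sq]
    simp
  rw [hsin] at key
  calc _ = (4 * π)⁻¹ * ((s ^ 2 - r ^ 2) / c.im ^ 2 * π) := by
        field_simp
    _ ≤ _ := by gcongr

/-! ### Functions that are extremal for the weight `-log y` -/

/-- The amount by which `(2 / k) * log ‖g z‖` falls short of the upper bound `ε - log (im z)`.
At a zero of `g` the value is meaningless, since there `Real.log ‖g z‖ = 0`. -/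
noncomputable def deficit (g : ℂ → ℂ) (k ε : ℝ) (z : ℂ) : ℝ := ε - log z.im - 2 / k * log ‖g z‖

lemma measurable_deficit {g : ℂ → ℂ} (hg : Measurable g) (k ε : ℝ) :
    Measurable (deficit g k ε) := by
  unfold deficit
  have h1 : Measurable fun z : ℂ => log z.im := measurable_log.comp Complex.measurable_im
  have h2 : Measurable fun z : ℂ => log ‖g z‖ := measurable_log.comp hg.norm
  fun_prop

lemma le_log_norm_of_exp_le {a k : ℝ} (hk : 0 < k) {w : ℂ} (h : exp (k * a) ≤ ‖w‖ ^ 2) :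
    a ≤ 2 / k * log ‖w‖ := by
  have h1 := log_le_log (exp_pos _) h
  rw [log_exp, log_pow] at h1
  rw [div_mul_eq_mul_div, le_div_iff₀ hk]
  push_cast at h1
  linarith

lemma log_norm_le_of_le_exp {a k : ℝ} (hk : 0 < k) {w : ℂ} (hw : w ≠ 0)
    (h : ‖w‖ ^ 2 ≤ exp (k * a)) : 2 / k * log ‖w‖ ≤ a := by
  have hw' : 0 < ‖w‖ := norm_pos_iff.mpr hw
  have h1 := log_le_log (by positivity) h
  rw [log_exp, log_pow] at h1
  rw [div_mul_eq_mul_div, div_le_iff₀ hk]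
  push_cast at h1
  linarith

lemma ae_circle_ne_zero {g : ℂ → ℂ} {c z₀ : ℂ} {s R : ℝ} (hs : 0 < s) (hsR : s ≤ R)
    (hg : AnalyticOnNhd ℂ g (closedBall c R)) (hz₀ : z₀ ∈ closedBall c R) (h0 : g z₀ ≠ 0) :
    ∀ᵐ θ, g (circleMap c s θ) ≠ 0 := by
  have hconn : IsConnected (closedBall c R) :=
    ⟨⟨z₀, hz₀⟩, (convex_closedBall c R).isPreconnected⟩
  have hcd := hg.preimage_zero_mem_codiscreteWithin h0 hz₀ hconn
  have hcd' : g ⁻¹' {0}ᶜ ∈ codiscreteWithin (sphere c |s|) := by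
    refine codiscreteWithin_mono ?_ hcd
    rw [abs_of_pos hs]
    exact sphere_subset_closedBall.trans (closedBall_subset_closedBall hsR)
  have := circleMap_preimage_codiscrete hs.ne' hcd'
  have h2 := ae_restrict_le_codiscreteWithin (μ := (volume : Measure ℝ)) (U := (univ : Set ℝ)) MeasurableSet.univ this
  rw [Measure.restrict_univ] at h2
  filter_upwards [h2] with θ hθ using hθ

lemma circleIntegrable_deficit {g : ℂ → ℂ} {k ε : ℝ} {c : ℂ} {s : ℝ} (h0 : 0 ≤ s) (hs : s < c.im)
    (hg : AnalyticOnNhd ℂ g (closedBall c s)) : CircleIntegrable (deficit g k ε) c s :=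
  ((circleIntegrable_const ε c s).sub (circleIntegrable_log_im h0 hs)).sub
    ((circleIntegrable_log_norm h0 hg).const_smul (a := 2 / k))

lemma circleAverage_deficit {g : ℂ → ℂ} {k ε : ℝ} {c : ℂ} {s : ℝ} (h0 : 0 ≤ s) (hs : s < c.im)
    (hg : AnalyticOnNhd ℂ g (closedBall c s)) :
    circleAverage (deficit g k ε) c s = ε - circleAverage (fun z => log z.im) c s -
      2 / k * circleAverage (fun z => log ‖g z‖) c s := by
  have h1 := circleIntegrable_const ε c s
  have h2 := circleIntegrable_log_im h0 hs
  have h3 := (circleIntegrable_log_norm h0 hg).const_smul (a := 2 / k)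
  have e : deficit g k ε = ((fun _ => ε) - fun z : ℂ => log z.im) -
    ((2 / k) • fun z => log ‖g z‖) := by
    ext z
    simp [deficit]
  rw [e, circleAverage_sub (h1.sub h2) h3, circleAverage_sub h1 h2, circleAverage_const,
    circleAverage_smul, smul_eq_mul]

/-- If `g` nearly attains its upper bound at the centre of a disc, then the deficit is small in
mean over the disc: `log ‖g‖` is subharmonic, and `-log y` lies within `O(ρ²)` of its mean over a
circle of radius `ρ`. -/
lemma lintegral_deficit_le {g : ℂ → ℂ} {k ε ρ : ℝ} {z : ℂ} (hk : 0 < k) (hm : Measurable g)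
    (hρ : 0 < ρ) (hρz : ρ ≤ z.im / 2) (hg : AnalyticOnNhd ℂ g (closedBall z ρ))
    (hup : ∀ w ∈ closedBall z ρ, ‖g w‖ ^ 2 ≤ exp (k * (ε - log w.im)))
    (hlow : exp (k * (-ε - log z.im)) ≤ ‖g z‖ ^ 2) :
    ∫⁻ w in ball z ρ, ENNReal.ofReal (deficit g k ε w) ≤
      ENNReal.ofReal (π * ρ ^ 2 * (ρ ^ 2 / z.im ^ 2 + 2 * ε)) := by
  have hz0 : g z ≠ 0 := by
    intro h
    rw [h] at hlow
    have := exp_pos (k * (-ε - log z.im))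
    simp at hlow
    linarith
  refine setLIntegral_ball_le hρ.le (measurable_deficit hm k ε).ennreal_ofReal fun s hs => ?_
  have hsz : s < z.im := by linarith [hs.2, hs.1]
  have hsub : closedBall z s ⊆ closedBall z ρ := closedBall_subset_closedBall hs.2.le
  have hgs := hg.mono hsub
  have hae : ∀ᵐ θ, 0 ≤ deficit g k ε (circleMap z s θ) := by
    filter_upwards [ae_circle_ne_zero hs.1 hs.2.le hg (mem_closedBall_self hρ.le) hz0] with θ hθ
    have := log_norm_le_of_le_exp hk hθ
      (hup _ (hsub (sphere_subset_closedBall (circleMap_mem_sphere z hs.1.le θ))))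
    unfold deficit
    linarith
  rw [lintegral_circle_eq (circleIntegrable_deficit hs.1.le hsz hgs) hae,
    circleAverage_deficit hs.1.le hsz hgs]
  have h1 := log_norm_le_circleAverage hs.1 hgs hz0
  have h2 := log_im_sub_le_circleAverage hs.1.le (by linarith [hs.2]) (show 0 < z.im by linarith)
  have h3 := le_log_norm_of_exp_le hk hlow
  -- The mean of the deficit is at most its value at the centre plus the error of the mean of `-log y`;
  -- the value at the centre is at most `2 * ε`.
  have h4 : 2 / k * log ‖g z‖ ≤ 2 / k * circleAverage (fun z => log ‖g z‖) z s := by gcongr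
  have h5 : s ^ 2 / z.im ^ 2 ≤ ρ ^ 2 / z.im ^ 2 := by
    have := hs.1.le
    have := hs.2.le
    gcongr
  apply ENNReal.ofReal_le_ofReal
  gcongr
  linarith

/-- The points of an `N × N` grid in the square of side `2 * R` centred at `c`. -/
noncomputable def gridPoint (c : ℂ) (R : ℝ) (N : ℕ) (p : Fin N × Fin N) : ℂ :=
  c + ⟨-R + 2 * R * p.1 / N, -R + 2 * R * p.2 / N⟩

lemma dist_gridPoint_le {c : ℂ} {R : ℝ} (hR : 0 < R) {N : ℕ} (p : Fin N × Fin N) :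
    dist (gridPoint c R N p) c ≤ 2 * R := by
  have aux (i : Fin N) : |-R + 2 * R * i / N| ≤ R := by
    have hN : (0 : ℝ) < N := by exact_mod_cast i.pos
    have h1 : (i : ℝ) ≤ N := by exact_mod_cast i.2.le
    have h2 : 2 * R * i / N ≤ 2 * R := by
      rw [div_le_iff₀ hN]
      gcongr
    have h3 : 0 ≤ 2 * R * i / N := by positivity
    rw [abs_le]
    constructor <;> linarith
  rw [dist_eq_norm, gridPoint, add_sub_cancel_left]
  refine (Complex.norm_le_abs_re_add_abs_im _).trans ?_
  have h1 := aux p.1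
  have h2 := aux p.2
  simp only
  linarith

lemma exists_dist_gridPoint_le {c z : ℂ} {R : ℝ} (hR : 0 < R) {N : ℕ} (hN : 0 < N)
    (hz : z ∈ ball c R) : ∃ p, dist z (gridPoint c R N p) ≤ 4 * R / N := by
  have hN' : (0 : ℝ) < N := by exact_mod_cast hN
  have aux (x : ℝ) (hx : |x| < R) : ∃ i : Fin N, |x - (-R + 2 * R * i / N)| ≤ 2 * R / N := by
    rw [abs_lt] at hx
    have h0 : 0 ≤ (x + R) * N / (2 * R) :=
      div_nonneg (mul_nonneg (by linarith) hN'.le) (by linarith)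
    have h1 : (x + R) * N / (2 * R) < N := by
      rw [div_lt_iff₀ (by linarith)]
      nlinarith
    refine ⟨⟨⌊(x + R) * N / (2 * R)⌋₊, (Nat.floor_lt h0).mpr h1⟩, ?_⟩
    have h2 := Nat.floor_le h0
    have h3 := (Nat.lt_floor_add_one ((x + R) * N / (2 * R))).le
    set i : ℝ := (⌊(x + R) * N / (2 * R)⌋₊ : ℝ)
    rw [le_div_iff₀ (by linarith)] at h2
    rw [div_le_iff₀ (by linarith)] at h3
    have h4 : 2 * R * i / N ≤ x + R := by
      rw [div_le_iff₀ hN']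
      linarith
    have h5 : x + R ≤ 2 * R * i / N + 2 * R / N := by
      rw [← add_div, le_div_iff₀ hN']
      linarith
    rw [abs_le]
    constructor
    · have : 0 ≤ 2 * R / N := by positivity
      linarith
    · linarith
  rw [mem_ball, dist_eq_norm] at hz
  obtain ⟨i, hi⟩ := aux (z - c).re ((Complex.abs_re_le_norm _).trans_lt hz)
  obtain ⟨j, hj⟩ := aux (z - c).im ((Complex.abs_im_le_norm _).trans_lt hz)
  refine ⟨(i, j), ?_⟩
  rw [dist_eq_norm, gridPoint, ← sub_sub]
  refine (Complex.norm_le_abs_re_add_abs_im _).trans ?_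
  rw [Complex.sub_re (z - c), Complex.sub_im (z - c)]
  calc _ ≤ 2 * R / N + 2 * R / N := add_le_add hi hj
    _ = _ := by ring

/-- The functions `g n` are asymptotically extremal for the weight `-log y` on `U`: up to `o(k n)`,
`log (‖g n‖ ^ 2)` is at most `-k n * log y`, locally uniformly, and almost attains this bound in
every disc. The bound `1 / 2 < y` on `U`, valid in the fundamental domain, serves to compare
the weight with its circle averages uniformly. -/
structure AsymptoticallyExtremal (U : Set ℂ) (k : ℕ → ℝ) (g : ℕ → ℂ → ℂ) : Prop where
  half_lt_im : ∀ z ∈ U, 1 / 2 < z.im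
  tendsto_weight : Tendsto k atTop atTop
  measurable : ∀ n, Measurable (g n)
  analytic : ∀ n, AnalyticOnNhd ℂ (g n) U
  upper : ∀ (c : ℂ) (ρ : ℝ), closedBall c ρ ⊆ U → ∀ ε > 0, ∀ᶠ n in atTop,
    ∀ z ∈ closedBall c ρ, ‖g n z‖ ^ 2 ≤ exp (k n * (ε - log z.im))
  lower : ∀ z ∈ U, ∀ δ > 0, ∀ ε > 0, ∀ᶠ n in atTop,
    ∃ z' ∈ ball z δ, exp (k n * (-ε - log z'.im)) ≤ ‖g n z'‖ ^ 2

/-- The deficits tend to zero in `L¹` on discs. The disc is covered by `N²` discs of radius `O(1/N)`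
around points where the upper bound is almost attained. Each of them contributes
`O(N⁻² * (N⁻² + ε))`, so that the sum is `O(N⁻² + ε)`. -/
lemma AsymptoticallyExtremal.eventually_lintegral_deficit_lt {U : Set ℂ} {k : ℕ → ℝ}
    {g : ℕ → ℂ → ℂ} (h : AsymptoticallyExtremal U k g) {c : ℂ} {R : ℝ} (hR : 0 < R)
    (hU : closedBall c (3 * R) ⊆ U) {η : ℝ} (hη : 0 < η) :
    ∃ ε > 0, ∀ᶠ n in atTop,
      ∫⁻ z in ball c R, ENNReal.ofReal (deficit (g n) (k n) ε z) < ENNReal.ofReal η := by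
  -- The discs have radius `5 * R / N`: `N ≥ 6` keeps them in the disc of radius `3 * R`, `N > 20 * R`
  -- makes the radii less than half the height, and the last term makes the total small.
  obtain ⟨N, hN⟩ : ∃ N : ℕ, 6 + 20 * R + 10000 * π * R ^ 4 / η < N := exists_nat_gt _
  have hq : 0 ≤ 10000 * π * R ^ 4 / η := by positivity
  have hN6 : (6 : ℝ) ≤ N := by linarith
  have hN0 : (0 : ℝ) < N := by linarith
  have hNR : 20 * R < N := by linarith
  have hNη : 10000 * π * R ^ 4 < η * N ^ 2 := by
    have h1 : 10000 * π * R ^ 4 / η < N := by linarith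
    rw [div_lt_iff₀ hη] at h1
    have h2 : N * η ≤ η * N ^ 2 := by
      rw [mul_comm, sq]
      gcongr
      nlinarith
    linarith
  set ε := η / (200 * π * R ^ 2) with hε
  have hε0 : 0 < ε := by positivity
  refine ⟨ε, hε0, ?_⟩
  have hδ : 0 < R / N := by positivity
  have hgrid (p : Fin N × Fin N) : gridPoint c R N p ∈ U :=
    hU (by rw [mem_closedBall]; linarith [dist_gridPoint_le (c := c) hR p])
  have hlow : ∀ᶠ n in atTop, ∀ p : Fin N × Fin N, ∃ z' ∈ ball (gridPoint c R N p) (R / N),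
      exp (k n * (-ε - log z'.im)) ≤ ‖g n z'‖ ^ 2 :=
    eventually_all.mpr fun p => h.lower _ (hgrid p) _ hδ ε hε0
  filter_upwards [hlow, h.upper c (3 * R) hU ε hε0, h.tendsto_weight.eventually_gt_atTop 0]
    with n hlow hup hk
  choose z hz hzlow using hlow
  have hRN : R / N ≤ R / 6 := by gcongr
  have hsub (p : Fin N × Fin N) : closedBall (z p) (5 * R / N) ⊆ closedBall c (3 * R) := by
    refine closedBall_subset_closedBall' ?_
    have h1 := dist_triangle (z p) (gridPoint c R N p) c
    have h2 := mem_ball.mp (hz p)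
    have h3 := dist_gridPoint_le (c := c) hR p
    have h4 : 5 * R / N = 5 * (R / N) := by ring
    linarith
  -- Every point is within `4 * R / N` of the grid, and `z p` is within `R / N` of its grid point.
  have hcover : ball c R ⊆ ⋃ p, ball (z p) (5 * R / N) := by
    intro w hw
    obtain ⟨p, hp⟩ := exists_dist_gridPoint_le hR (by exact_mod_cast hN0) hw (N := N)
    refine mem_iUnion.mpr ⟨p, ?_⟩
    have h1 := dist_triangle w (gridPoint c R N p) (z p)
    have h2 := mem_ball'.mp (hz p)
    rw [mem_ball]
    have h4 : 5 * R / N = 4 * R / N + R / N := by ring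
    linarith
  have hone (p : Fin N × Fin N) :
      ∫⁻ w in ball (z p) (5 * R / N), ENNReal.ofReal (deficit (g n) (k n) ε w) ≤
        ENNReal.ofReal (π * (5 * R / N) ^ 2 * (4 * (5 * R / N) ^ 2 + 2 * ε)) := by
    have him : 1 / 2 < (z p).im :=
      h.half_lt_im _ (hU (hsub p (mem_closedBall_self (by positivity))))
    have h5 : 5 * R / N ≤ 1 / 4 := by
      rw [div_le_iff₀ hN0]
      linarith
    refine (lintegral_deficit_le hk (h.measurable n) (by positivity) (by linarith)
      ((h.analytic n).mono ((hsub p).trans hU)) (fun w hw => hup w (hsub p hw))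
      (hzlow p)).trans ?_
    apply ENNReal.ofReal_le_ofReal
    gcongr
    rw [div_le_iff₀ (by positivity)]
    have h6 : 1 ≤ 4 * (z p).im ^ 2 := by nlinarith
    nlinarith [sq_nonneg (5 * R / N)]
  calc ∫⁻ w in ball c R, ENNReal.ofReal (deficit (g n) (k n) ε w)
      ≤ ∫⁻ w in ⋃ p, ball (z p) (5 * R / N), ENNReal.ofReal (deficit (g n) (k n) ε w) :=
        lintegral_mono_set hcover
    _ ≤ ∑' p, ∫⁻ w in ball (z p) (5 * R / N), ENNReal.ofReal (deficit (g n) (k n) ε w) :=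
        lintegral_iUnion_le _ _
    _ ≤ ∑' _ : Fin N × Fin N,
          ENNReal.ofReal (π * (5 * R / N) ^ 2 * (4 * (5 * R / N) ^ 2 + 2 * ε)) :=
        ENNReal.tsum_le_tsum hone
    _ = ENNReal.ofReal (N ^ 2 * (π * (5 * R / N) ^ 2 * (4 * (5 * R / N) ^ 2 + 2 * ε))) := by
        rw [tsum_fintype, Finset.sum_const, nsmul_eq_mul,
          ENNReal.ofReal_mul (p := (N : ℝ) ^ 2) (by positivity),
          ENNReal.ofReal_pow hN0.le, ENNReal.ofReal_natCast]
        congr 1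
        simp [sq]
    _ < ENNReal.ofReal η := by
        rw [ENNReal.ofReal_lt_ofReal_iff hη]
        have h7 : (N : ℝ) ^ 2 * (π * (5 * R / N) ^ 2 * (4 * (5 * R / N) ^ 2 + 2 * ε)) =
            10000 * π * R ^ 4 / (4 * N ^ 2) + η / 4 := by
          rw [hε]
          field_simp
          ring
        have h8 : 10000 * π * R ^ 4 / (4 * N ^ 2) < η / 4 := by
          rw [div_lt_div_iff₀ (by positivity) (by norm_num)]
          linarith
        linarith

/-- Lower bound for the number of zeros in a disc. By Jensen's formula the zeros in a
disc of radius `s` about `c` number at least `(mean over C(s) - mean over C(r)) / log (s / r)`, where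
the means are those of `log ‖g n‖`; up to `o(k n)` these are half the means of `-k n * log y`. -/
lemma AsymptoticallyExtremal.eventually_le_sum_order {U : Set ℂ} {k : ℕ → ℝ}
    {g : ℕ → ℂ → ℂ} (h : AsymptoticallyExtremal U k g) {c : ℂ} {r R : ℝ} (hr : 0 < r) (hrR : r < R)
    (hRc : R ≤ c.im) (hU : closedBall c (3 * R) ⊆ U) {η : ℝ} (hη : 0 < η) :
    ∀ᶠ n in atTop, ∃ T : Finset ℂ, (T : Set ℂ) ⊆ ball c R ∧
      3 * r ^ 2 / c.im ^ 2 - η ≤ 12 / k n * ∑ u ∈ T, (analyticOrderNatAt (g n) u : ℝ) := by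
  have hR : 0 < R := hr.trans hrR
  -- The good circle is looked for between the radii `ρ` and `R`, so that its radius stays away from
  -- `r` and an error of `η * L / 6` in the means is harmless after division by `log (s / r) ≥ L`.
  set ρ := (r + R) / 2 with hρ
  have hrρ : r < ρ := by linarith
  have hρR : ρ < R := by linarith
  have hρ0 : 0 < ρ := by linarith
  set L := log (ρ / r) with hL
  have hL0 : 0 < L := log_pos (by rwa [one_lt_div hr])
  set A := 2 * π * (η * L / 6) with hA
  have hA0 : 0 < A := by positivity
  obtain ⟨ε, hε, hev⟩ := h.eventually_lintegral_deficit_lt hR hU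
    (show 0 < ρ * (R - ρ) * A from mul_pos (mul_pos hρ0 (by linarith)) hA0)
  have hRsub : closedBall c R ⊆ U := (closedBall_subset_closedBall (by linarith)).trans hU
  have hup := h.upper c R hRsub ε hε
  filter_upwards [hev, hup, h.tendsto_weight.eventually_gt_atTop 0,
    h.lower c (hRsub (mem_closedBall_self hR.le)) R hR ε hε] with n hint hup hk hlow
  obtain ⟨z₀, hz₀, hz₀low⟩ := hlow
  -- A point where `g n` does not vanish is needed for its zeros to be a null set on circles.
  have hg0 : g n z₀ ≠ 0 := by
    intro h0
    rw [h0] at hz₀low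
    have := exp_pos (k n * (-ε - log z₀.im))
    simp at hz₀low
    linarith
  have hg := (h.analytic n).mono hRsub
  obtain ⟨s, hs, hsint⟩ := exists_circle_lintegral_le hρ0 hA0
    (measurable_deficit (h.measurable n) (k n) ε).ennreal_ofReal hint
  have hrs : r < s := hrρ.trans hs.1
  have hs0 : 0 < s := hr.trans hrs
  have hsc : s < c.im := hs.2.trans_le hRc
  have hgs := hg.mono (closedBall_subset_closedBall hs.2.le)
  have hgr := hg.mono (closedBall_subset_closedBall hrR.le)
  obtain ⟨T, hT, hJ⟩ := circleAverage_sub_le_sum_order hr hrs.le hgs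
  refine ⟨T, hT.trans (closedBall_subset_ball hs.2), ?_⟩
  -- The mean of the deficit is small on the circle of radius `s` and nonnegative on that of radius `r`,
  -- so that the means of `log ‖g n‖` grow almost as much as those of `-log y`.
  have h1 := circleAverage_le_of_lintegral_le (by positivity)
    (circleIntegrable_deficit hs0.le hsc hgs) hsint
  rw [circleAverage_deficit hs0.le hsc hgs] at h1
  have h2 : 0 ≤ circleAverage (deficit (g n) (k n) ε) c r := by
    rw [← circleAverage_const (0 : ℝ) c r]
    refine circleAverage_mono_ae (circleIntegrable_const _ _ _)
      (circleIntegrable_deficit hr.le (hrs.trans hsc) hgr) ?_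
    filter_upwards [ae_circle_ne_zero hr hrR.le hg (ball_subset_closedBall hz₀) hg0] with θ hθ
    have := log_norm_le_of_le_exp hk hθ (hup _ (closedBall_subset_closedBall hrR.le
      (sphere_subset_closedBall (circleMap_mem_sphere c hr.le θ))))
    unfold deficit
    linarith
  rw [circleAverage_deficit hr.le (hrs.trans hsc) hgr] at h2
  have h3 := circleAverage_log_im_sub hr.le hrs.le hsc
  set as := circleAverage (fun z => log ‖g n z‖) c s
  set ar := circleAverage (fun z => log ‖g n z‖) c r
  set S := ∑ u ∈ T, (analyticOrderNatAt (g n) u : ℝ)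
  have h4 : (s ^ 2 - r ^ 2) / (4 * c.im ^ 2) - η * L / 6 ≤ 2 / k n * (as - ar) := by
    rw [mul_sub]
    linarith
  have hls : L ≤ log (s / r) := by
    apply log_le_log (by positivity)
    gcongr
    exact hs.1.le
  have hls0 := hL0.trans_le hls
  have h5 : 2 / k n * (as - ar) ≤ 2 / k n * (S * log (s / r)) := by gcongr
  -- This makes the growth of the means, divided by `log (s / r)`, at least `r ^ 2 / (2 * c.im ^ 2)`,
  -- whatever `s` is.
  have h6 : log (s / r) ≤ (s ^ 2 - r ^ 2) / (2 * r ^ 2) := by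
    have h7 := log_le_sub_one_of_pos (show 0 < (s / r) ^ 2 by positivity)
    rw [log_pow] at h7
    push_cast at h7
    have h8 : (s ^ 2 - r ^ 2) / (2 * r ^ 2) = ((s / r) ^ 2 - 1) / 2 := by field_simp
    linarith
  have hc : 0 < c.im := by linarith
  have h9 : log (s / r) * (r ^ 2 / (2 * c.im ^ 2)) ≤ (s ^ 2 - r ^ 2) / (4 * c.im ^ 2) := by
    calc _ ≤ (s ^ 2 - r ^ 2) / (2 * r ^ 2) * (r ^ 2 / (2 * c.im ^ 2)) := by gcongr
      _ = _ := by
        field_simp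
        ring
  have h10 : η * L / 6 ≤ log (s / r) * (η / 6) := by nlinarith
  have h11 : log (s / r) * (r ^ 2 / (2 * c.im ^ 2) - η / 6) ≤ log (s / r) * (2 / k n * S) := by
    calc _ = log (s / r) * (r ^ 2 / (2 * c.im ^ 2)) - log (s / r) * (η / 6) := by ring
      _ ≤ 2 / k n * (S * log (s / r)) := by linarith
      _ = _ := by ring
  have h12 := le_of_mul_le_mul_left h11 hls0
  calc 3 * r ^ 2 / c.im ^ 2 - η = 6 * (r ^ 2 / (2 * c.im ^ 2) - η / 6) := by
        field_simp
        ring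
    _ ≤ 6 * (2 / k n * S) := by gcongr
    _ = _ := by ring

/-! ### The measure on the modular domain -/

lemma lintegral_Ioi_inv_sq {a : ℝ} (ha : 0 < a) :
    ∫⁻ y in Ioi a, ENNReal.ofReal (1 / y ^ 2) = ENNReal.ofReal (1 / a) := by
  have hrp : ∀ y ∈ Ioi a, y ^ (-2 : ℝ) = 1 / y ^ 2 := by
    intro y hy
    rw [rpow_neg (ha.trans hy).le, one_div]
    norm_cast
  have hint : IntegrableOn (fun y : ℝ => 1 / y ^ 2) (Ioi a) :=
    (integrableOn_Ioi_rpow_of_lt (by norm_num) ha).congr_fun hrp measurableSet_Ioi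
  rw [← ofReal_integral_eq_lintegral_ofReal hint (ae_of_all _ fun y => by positivity),
    ← setIntegral_congr_fun measurableSet_Ioi hrp, integral_Ioi_rpow_of_lt (by norm_num) ha]
  congr 1
  norm_num [rpow_neg_one]

lemma lintegral_inv_sqrt_one_sub_sq :
    ∫⁻ x in Ioo (-(1 / 2) : ℝ) (1 / 2), ENNReal.ofReal (1 / √(1 - x ^ 2)) =
      ENNReal.ofReal (π / 3) := by
  have hcont : ContinuousOn (fun x : ℝ => 1 / √(1 - x ^ 2)) (Icc (-(1 / 2)) (1 / 2)) := by
    refine continuousOn_const.div (by fun_prop) fun x hx => ?_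
    exact (sqrt_pos.mpr (by nlinarith [hx.1, hx.2])).ne'
  have hint : IntegrableOn (fun x : ℝ => 1 / √(1 - x ^ 2)) (Ioo (-(1 / 2)) (1 / 2)) :=
    hcont.integrableOn_Icc.mono_set Ioo_subset_Icc_self
  rw [← ofReal_integral_eq_lintegral_ofReal hint (ae_of_all _ fun x => by positivity),
    ← integral_Ioc_eq_integral_Ioo, ← intervalIntegral.integral_of_le (by norm_num)]
  have hle : (-(1 / 2) : ℝ) ≤ 1 / 2 := by norm_num
  rw [intervalIntegral.integral_eq_sub_of_hasDerivAt (f := arcsin)]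
  · have h1 : arcsin (1 / 2) = π / 6 := by
      rw [← sin_pi_div_six, arcsin_sin] <;> linarith [pi_pos]
    rw [arcsin_neg, h1]
    congr 1
    ring
  · intro x hx
    rw [uIcc_of_le hle] at hx
    exact hasDerivAt_arcsin (by linarith [hx.1]) (by linarith [hx.2])
  · refine ContinuousOn.intervalIntegrable ?_
    rwa [uIcc_of_le hle]

/-- The area above the unit circle in a vertical strip of width one; the boundary of the region may
or may not be included. -/
lemma lintegral_strip {S : Set ℂ} (hS : MeasurableSet S) {J : Set ℝ} {K : ℝ → Set ℝ}
    (hJ : J =ᵐ[volume] Ioo (-(1 / 2) : ℝ) (1 / 2)) (hJsub : J ⊆ Icc (-(1 / 2)) (1 / 2))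
    (hJm : MeasurableSet J) (hKm : ∀ a, MeasurableSet (K a))
    (hK : ∀ a, K a =ᵐ[volume] Ioi a)
    (hmem : ∀ z : ℂ, z ∈ S ↔ z.re ∈ J ∧ z.im ∈ K (√(1 - z.re ^ 2))) :
    ∫⁻ z in S, ENNReal.ofReal (1 / z.im ^ 2) = ENNReal.ofReal (π / 3) := by
  rw [← lintegral_indicator hS,
    ← (Complex.volume_preserving_equiv_real_prod.symm).lintegral_comp_emb
      Complex.measurableEquivRealProd.symm.measurableEmbedding, Measure.volume_eq_prod,
    lintegral_prod _ (by
      refine Measurable.aemeasurable ?_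
      refine Measurable.comp (g := S.indicator fun z : ℂ => ENNReal.ofReal (1 / z.im ^ 2)) ?_
        Complex.measurableEquivRealProd.symm.measurable
      refine Measurable.indicator ?_ hS
      have := Complex.measurable_im
      fun_prop)]
  have hinner (x : ℝ) : ∫⁻ y, S.indicator (fun z : ℂ => ENNReal.ofReal (1 / z.im ^ 2))
      (Complex.measurableEquivRealProd.symm (x, y)) =
      J.indicator (fun x => ENNReal.ofReal (1 / √(1 - x ^ 2))) x := by
    by_cases hx : x ∈ J
    · have hpos : 0 < √(1 - x ^ 2) :=
        sqrt_pos.mpr (by nlinarith [(hJsub hx).1, (hJsub hx).2])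
      rw [indicator_of_mem hx, ← lintegral_Ioi_inv_sq hpos, ← setLIntegral_congr (hK _),
        ← lintegral_indicator (hKm _)]
      refine lintegral_congr fun y => ?_
      have hiff : (Complex.measurableEquivRealProd.symm (x, y)) ∈ S ↔ y ∈ K (√(1 - x ^ 2)) := by
        rw [hmem]
        simp [Complex.measurableEquivRealProd_symm_apply, hx]
      by_cases hy : y ∈ K (√(1 - x ^ 2))
      · rw [indicator_of_mem hy, indicator_of_mem (hiff.mpr hy)]
        simp [Complex.measurableEquivRealProd_symm_apply]
      · rw [indicator_of_notMem hy, indicator_of_notMem (fun h => hy (hiff.mp h))]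
    · rw [indicator_of_notMem hx]
      have hz (y : ℝ) : S.indicator (fun z : ℂ => ENNReal.ofReal (1 / z.im ^ 2))
          (Complex.measurableEquivRealProd.symm (x, y)) = 0 := by
        refine indicator_of_notMem (fun h => hx ?_) _
        simpa [Complex.measurableEquivRealProd_symm_apply] using ((hmem _).mp h).1
      exact (lintegral_congr hz).trans lintegral_zero
  simp_rw [hinner]
  rw [lintegral_indicator hJm, setLIntegral_congr hJ, lintegral_inv_sqrt_one_sub_sq]

lemma volume_eq_lintegral_ofReal (s : Set ℍ) :
    volume s = ∫⁻ z : ℂ in UpperHalfPlane.coe '' s, ENNReal.ofReal (1 / z.im ^ 2) := by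
  rw [UpperHalfPlane.volume_eq_lintegral]
  refine lintegral_congr fun z => ?_
  rw [← ENNReal.ofReal_coe_nnreal]
  congr 1
  simp

lemma mem_coe_fdo_iff (z : ℂ) : z ∈ UpperHalfPlane.coe '' ModularGroup.fdo ↔
    z.re ∈ Ioo (-(1 / 2) : ℝ) (1 / 2) ∧ z.im ∈ Ioi (√(1 - z.re ^ 2)) := by
  rw [ModularGroup.coe_fdo, mem_ofPred_eq, mem_Ioo, mem_Ioi, abs_lt]
  have hn : ‖z‖ ^ 2 = z.re ^ 2 + z.im ^ 2 := by
    rw [← Complex.normSq_eq_norm_sq, Complex.normSq_apply]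
    ring
  constructor
  · rintro ⟨h1, h2, h3⟩
    refine ⟨h3, ?_⟩
    rw [sqrt_lt' h1]
    nlinarith [norm_nonneg z]
  · rintro ⟨h1, h2⟩
    have h0 := (sqrt_nonneg _).trans_lt h2
    refine ⟨h0, ?_, h1⟩
    rw [sqrt_lt' h0] at h2
    nlinarith [norm_nonneg z]

lemma mem_coe_fd_iff (z : ℂ) : z ∈ UpperHalfPlane.coe '' ModularGroup.fd ↔
    z.re ∈ Icc (-(1 / 2) : ℝ) (1 / 2) ∧ z.im ∈ Ici (√(1 - z.re ^ 2)) := by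
  rw [ModularGroup.coe_fd, mem_ofPred_eq, mem_Icc, mem_Ici, abs_le]
  have hn : ‖z‖ ^ 2 = z.re ^ 2 + z.im ^ 2 := by
    rw [← Complex.normSq_eq_norm_sq, Complex.normSq_apply]
    ring
  constructor
  · rintro ⟨h1, h2, h3⟩
    refine ⟨h3, ?_⟩
    rw [sqrt_le_left h1.le]
    nlinarith [norm_nonneg z]
  · rintro ⟨h1, h2⟩
    have h0 : 0 < z.im := (sqrt_pos.mpr (by nlinarith [h1.1, h1.2])).trans_le h2
    refine ⟨h0, ?_, h1⟩
    rw [sqrt_le_left h0.le] at h2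
    nlinarith [norm_nonneg z]

lemma measurableSet_coe_image {s : Set ℍ} (hs : MeasurableSet s) :
    MeasurableSet (UpperHalfPlane.coe '' s) :=
  UpperHalfPlane.measurableEmbedding_coe.measurableSet_image.mpr hs

lemma volume_fdo : volume ModularGroup.fdo = ENNReal.ofReal (π / 3) := by
  rw [volume_eq_lintegral_ofReal]
  exact lintegral_strip (measurableSet_coe_image ModularGroup.isOpen_fdo.measurableSet)
    (EventuallyEq.refl _ _) Ioo_subset_Icc_self measurableSet_Ioo (fun _ => measurableSet_Ioi)
    (fun _ => EventuallyEq.refl _ _) mem_coe_fdo_iff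

lemma volume_fd : volume ModularGroup.fd = ENNReal.ofReal (π / 3) := by
  rw [volume_eq_lintegral_ofReal]
  exact lintegral_strip (measurableSet_coe_image ModularGroup.isClosed_fd.measurableSet)
    Ioo_ae_eq_Icc.symm subset_rfl measurableSet_Icc (fun _ => measurableSet_Ici)
    (fun _ => Ioi_ae_eq_Ici.symm) mem_coe_fd_iff

lemma fdo_ae_eq_fd : (ModularGroup.fdo : Set ℍ) =ᵐ[volume] ModularGroup.fd :=
  ae_eq_of_subset_of_measure_ge ModularGroup.fdo_subset_fd (by rw [volume_fd, volume_fdo])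
    ModularGroup.isOpen_fdo.measurableSet.nullMeasurableSet
    (by rw [volume_fd]; exact ENNReal.ofReal_ne_top)

instance : IsIsometricSMul SL(2, ℤ) ℍ := by
  refine ⟨fun g => ?_⟩
  have h : (fun z : ℍ => g • z) =
      fun z => (Matrix.SpecialLinearGroup.map (Int.castRingHom ℝ) g) • z := by
    ext z
    rw [UpperHalfPlane.coe_specialLinearGroup_apply, UpperHalfPlane.coe_specialLinearGroup_apply]
    simp
  rw [h]
  exact isometry_smul ℍ (Matrix.SpecialLinearGroup.map (Int.castRingHom ℝ) g)

lemma continuous_proj : Continuous proj := continuous_quot_mk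

lemma proj_smul (g : SL(2, ℤ)) (z : ℍ) : proj (g • z) = proj z :=
  Quotient.sound ⟨g, rfl⟩

lemma proj_eq_iff {z z' : ℍ} : proj z = proj z' ↔ ∃ g : SL(2, ℤ), g • z' = z := by
  unfold proj
  rw [Quotient.eq]
  exact Iff.rfl

lemma proj_surjective : Function.Surjective proj := Quot.mk_surjective

lemma measurable_proj : Measurable proj := fun _ => id

lemma isOpen_iff_proj {s : Set ModularDomain} : IsOpen s ↔ IsOpen (proj ⁻¹' s) := Iff.rfl

lemma measurableSet_iff_proj {s : Set ModularDomain} :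
    MeasurableSet s ↔ MeasurableSet (proj ⁻¹' s) := Iff.rfl

instance : OpensMeasurableSpace ModularDomain :=
  ⟨MeasurableSpace.generateFrom_le fun _ hs =>
    measurableSet_iff_proj.mpr (isOpen_iff_proj.mp hs).measurableSet⟩

instance : MeasurableSingletonClass ModularDomain := by
  refine ⟨fun x => ?_⟩
  obtain ⟨z, rfl⟩ := proj_surjective x
  rw [measurableSet_iff_proj]
  have h : proj ⁻¹' {proj z} = range fun g : SL(2, ℤ) => g • z := by
    ext z'
    simp [proj_eq_iff]
  rw [h]
  have : Countable SL(2, ℤ) :=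
    (Subtype.val_injective (p := fun A : Matrix (Fin 2) (Fin 2) ℤ => A.det = 1)).countable
      (β := Fin 2 → Fin 2 → ℤ)
  exact (countable_range _).measurableSet

lemma dV_apply {s : Set ModularDomain} (hs : MeasurableSet s) :
    dV s = ENNReal.ofReal (3 / π) * volume (proj ⁻¹' s ∩ ModularGroup.fdo) := by
  rw [dV, Measure.smul_apply, Measure.map_apply measurable_proj hs, smul_eq_mul,
    Measure.restrict_congr_set fdo_ae_eq_fd.symm,
    Measure.restrict_apply (measurableSet_iff_proj.mp hs)]

lemma lintegral_dV {F : ModularDomain → ℝ≥0∞} (hF : Measurable F) :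
    ∫⁻ x, F x ∂dV =
      ENNReal.ofReal (3 / π) * ∫⁻ z in (ModularGroup.fdo : Set ℍ), F (proj z) := by
  rw [dV, lintegral_smul_measure, lintegral_map hF measurable_proj, smul_eq_mul,
    Measure.restrict_congr_set fdo_ae_eq_fd.symm]

instance : IsProbabilityMeasure dV := by
  refine ⟨?_⟩
  rw [dV_apply MeasurableSet.univ, preimage_univ, univ_inter, volume_fdo,
    ← ENNReal.ofReal_mul (by positivity)]
  have : 3 / π * (π / 3) = 1 := by field_simp
  rw [this, ENNReal.ofReal_one]

/-- Integration over `ℍ` in terms of Lebesgue measure on `ℂ`. -/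
lemma setLIntegral_coe_image {F : ℍ → ℝ≥0∞} (hF : Measurable F) {s : Set ℍ}
    (hs : MeasurableSet s) :
    ∫⁻ z in s, F z = ∫⁻ u in UpperHalfPlane.coe '' s,
      ENNReal.ofReal (1 / u.im ^ 2) * F (UpperHalfPlane.ofComplex u) := by
  have hd : Measurable fun z : ℍ =>
      (((1 / NNReal.mk z.im z.im_pos.le : NNReal) ^ 2 : NNReal) : ℝ≥0∞) := by
    have : Measurable fun z : ℍ => NNReal.mk z.im z.im_pos.le :=
      (UpperHalfPlane.continuous_im.measurable).subtype_mk
    fun_prop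
  rw [UpperHalfPlane.volume_def, setLIntegral_withDensity_eq_setLIntegral_mul _ hd hF hs]
  have hmp : MeasurePreserving UpperHalfPlane.coe (volume.comap UpperHalfPlane.coe)
      (volume.restrict (range UpperHalfPlane.coe)) :=
    ⟨UpperHalfPlane.measurable_coe, by rw [UpperHalfPlane.measurableEmbedding_coe.map_comap]⟩
  have hr := hmp.setLIntegral_comp_emb UpperHalfPlane.measurableEmbedding_coe
    (fun u => ENNReal.ofReal (1 / u.im ^ 2) * F (UpperHalfPlane.ofComplex u)) s
  rw [Measure.restrict_restrict (measurableSet_coe_image hs),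
    inter_eq_self_of_subset_left (image_subset_range _ _)] at hr
  rw [← hr]
  refine lintegral_congr fun z => ?_
  simp only [Pi.mul_apply, UpperHalfPlane.ofComplex_apply]
  congr 1
  rw [← ENNReal.ofReal_coe_nnreal]
  congr 1
  simp

/-! ### Cusp forms are asymptotically extremal in the fundamental domain -/

lemma exp_intCast_mul (x : ℝ) (n : ℤ) : exp (n * x) = exp x ^ n := by
  rw [mul_comm, exp_mul, rpow_intCast]

lemma measurable_ofComplex : Measurable UpperHalfPlane.ofComplex := by
  have hc : Measurable fun u : ℂ => (UpperHalfPlane.ofComplex u : ℂ) := by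
    have h : (fun u : ℂ => (UpperHalfPlane.ofComplex u : ℂ)) = fun u : ℂ =>
        if 0 < u.im then u else ((Classical.choice inferInstance : ℍ) : ℂ) := by
      ext u
      rw [UpperHalfPlane.ofComplex_apply_eq_ite]
      split_ifs <;> rfl
    rw [h]
    exact Measurable.ite (measurableSet_lt measurable_const Complex.measurable_im) measurable_id
      measurable_const
  exact UpperHalfPlane.measurableEmbedding_coe.measurable_comp_iff.mp hc

lemma continuous_cuspForm {k : ℤ} (f : CuspForm 𝒮ℒ k) : Continuous f := f.holo'.continuous

lemma analyticAt_comp_ofComplex {k : ℤ} (f : CuspForm 𝒮ℒ k) {u : ℂ} (hu : 0 < u.im) :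
    AnalyticAt ℂ (fun s : ℂ => f (UpperHalfPlane.ofComplex s)) u :=
  (UpperHalfPlane.mdifferentiable_iff.mp f.holo').analyticAt
    (UpperHalfPlane.isOpen_upperHalfPlaneSet.mem_nhds hu)

lemma measurable_comp_ofComplex {k : ℤ} (f : CuspForm 𝒮ℒ k) :
    Measurable fun s : ℂ => f (UpperHalfPlane.ofComplex s) :=
  (continuous_cuspForm f).measurable.comp measurable_ofComplex

lemma mass_proj {k : ℤ} (f : CuspForm 𝒮ℒ k) (z : ℍ) : mass f (proj z) = z.im ^ k * ‖f z‖ ^ 2 := rfl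

lemma mass_nonneg {k : ℤ} (f : CuspForm 𝒮ℒ k) (x : ModularDomain) : 0 ≤ mass f x := by
  obtain ⟨z, rfl⟩ := proj_surjective x
  rw [mass_proj]
  have := z.im_pos
  positivity

lemma continuous_mass {k : ℤ} (f : CuspForm 𝒮ℒ k) : Continuous (mass f) := by
  refine Continuous.quotient_lift ?_ _
  exact (UpperHalfPlane.continuous_im.zpow₀ k fun z => Or.inl z.im_ne_zero).mul
    ((continuous_cuspForm f).norm.pow 2)

lemma lintegral_mass {k : ℤ} {f : CuspForm 𝒮ℒ k} (hf : L2Normalized f) :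
    ∫⁻ x, ENNReal.ofReal (mass f x) ∂dV = 1 := by
  unfold L2Normalized at hf
  have hint : Integrable (mass f) dV := by
    by_contra h
    rw [integral_undef h] at hf
    exact zero_ne_one hf
  rw [← ofReal_integral_eq_lintegral_ofReal hint (ae_of_all _ (mass_nonneg f)), hf,
    ENNReal.ofReal_one]

lemma norm_sq_le_circleAverage {g : ℂ → ℂ} {c : ℂ} {r : ℝ} (hr : 0 < r)
    (hg : AnalyticOnNhd ℂ g (closedBall c r)) :
    ‖g c‖ ^ 2 ≤ circleAverage (fun z => ‖g z‖ ^ 2) c r := by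
  have hd : DiffContOnCl ℂ (fun z => g z ^ 2) (ball c |r|) := by
    rw [abs_of_pos hr]
    exact ((hg.differentiableOn.pow 2).mono closure_ball_subset_closedBall).diffContOnCl
  rw [← norm_pow, ← hd.circleAverage, circleAverage, circleAverage, norm_smul, smul_eq_mul,
    norm_of_nonneg (by positivity)]
  gcongr
  refine (intervalIntegral.norm_integral_le_integral_norm (by positivity)).trans_eq ?_
  simp_rw [norm_pow]

lemma half_lt_im_of_mem_coe_fdo {z : ℂ} (hz : z ∈ UpperHalfPlane.coe '' ModularGroup.fdo) :
    1 / 2 < z.im := by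
  obtain ⟨τ, hτ, rfl⟩ := hz
  have h1 := ModularGroup.three_lt_four_mul_im_sq_of_mem_fdo hτ
  have h2 := τ.im_pos
  rw [UpperHalfPlane.coe_im]
  nlinarith

/-- A pointwise bound for an `L²`-normalized form, from the sub-mean value property. -/
lemma norm_sq_mul_le_one {k : ℤ} {f : CuspForm 𝒮ℒ k} (hf : L2Normalized f) (hk : 2 ≤ k)
    {z : ℂ} {r : ℝ} (hr : 0 < r) (hrz : r < z.im)
    (hsub : closedBall z r ⊆ UpperHalfPlane.coe '' ModularGroup.fdo) :
    3 * r ^ 2 * (z.im - r) ^ (k - 2) * ‖f (UpperHalfPlane.ofComplex z)‖ ^ 2 ≤ 1 := by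
  set g : ℂ → ℂ := fun s => f (UpperHalfPlane.ofComplex s) with hg
  have hgm : Measurable g := measurable_comp_ofComplex f
  have hga : AnalyticOnNhd ℂ g (closedBall z r) := fun u hu =>
    analyticAt_comp_ofComplex f (by linarith [half_lt_im_of_mem_coe_fdo (hsub hu)])
  have hyr : 0 < z.im - r := by linarith
  have h1 : ENNReal.ofReal (π * r ^ 2 * ‖g z‖ ^ 2) ≤
      ∫⁻ u in ball z r, ENNReal.ofReal (‖g u‖ ^ 2) := by
    refine le_setLIntegral_ball hr.le (by fun_prop) fun s hs => ?_
    have hgs := hga.mono (closedBall_subset_closedBall hs.2.le)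
    have hci : CircleIntegrable (fun u => ‖g u‖ ^ 2) z s :=
      ((hgs.continuousOn.mono sphere_subset_closedBall).norm.pow 2).circleIntegrable hs.1.le
    rw [lintegral_circle_eq hci (ae_of_all _ fun θ => by positivity)]
    apply ENNReal.ofReal_le_ofReal
    have := norm_sq_le_circleAverage hs.1 hgs
    gcongr
  have h2 : ENNReal.ofReal ((z.im - r) ^ (k - 2)) * ∫⁻ u in ball z r, ENNReal.ofReal (‖g u‖ ^ 2) ≤
      ∫⁻ u in ball z r, ENNReal.ofReal (1 / u.im ^ 2) *
        ENNReal.ofReal (mass f (proj (UpperHalfPlane.ofComplex u))) := by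
    rw [← lintegral_const_mul _ (by fun_prop)]
    refine setLIntegral_mono' measurableSet_ball fun u hu => ?_
    rw [← ENNReal.ofReal_mul (by positivity), ← ENNReal.ofReal_mul (by positivity)]
    apply ENNReal.ofReal_le_ofReal
    have him : z.im - r ≤ u.im := by
      rw [mem_ball, dist_eq_norm] at hu
      have h1 := Complex.abs_im_le_norm (u - z)
      rw [Complex.sub_im, abs_le] at h1
      linarith
    have hu0 : 0 < u.im := by linarith
    rw [mass_proj, UpperHalfPlane.ofComplex_apply_of_im_pos hu0]
    have h3 : 1 / u.im ^ 2 * (u.im ^ k * ‖f ⟨u, hu0⟩‖ ^ 2) = u.im ^ (k - 2) * ‖g u‖ ^ 2 := by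
      rw [hg]
      simp only [UpperHalfPlane.ofComplex_apply_of_im_pos hu0]
      rw [zpow_sub₀ hu0.ne']
      norm_cast
      field_simp
    refine le_of_le_of_eq ?_ h3.symm
    gcongr
    exact zpow_le_zpow_left₀ (by omega) hyr.le him
  -- The part of the total mass `1` that lies in the disc bounds the area integral.
  have h4 := lintegral_mass hf
  rw [lintegral_dV (continuous_mass f).measurable.ennreal_ofReal, setLIntegral_coe_image
    (F := fun τ => ENNReal.ofReal (mass f (proj τ)))
    ((continuous_mass f).measurable.ennreal_ofReal.comp measurable_proj)
    ModularGroup.isOpen_fdo.measurableSet] at h4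
  have h5 : ENNReal.ofReal (3 / π) * (ENNReal.ofReal ((z.im - r) ^ (k - 2)) *
      ENNReal.ofReal (π * r ^ 2 * ‖g z‖ ^ 2)) ≤ 1 := by
    rw [← h4]
    gcongr
    refine (mul_le_mul_right h1 _).trans (h2.trans ?_)
    exact lintegral_mono_set (ball_subset_closedBall.trans hsub)
  rw [← ENNReal.ofReal_mul (by positivity), ← ENNReal.ofReal_mul (by positivity),
    ENNReal.ofReal_le_one] at h5
  change 3 * r ^ 2 * (z.im - r) ^ (k - 2) * ‖g z‖ ^ 2 ≤ 1
  refine le_of_eq_of_le ?_ h5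
  field_simp

/-- The upper bound is uniform on compact subsets of the fundamental domain: it comes from the `L²`
norm alone. -/
lemma eventually_norm_sq_le_exp {k : ℕ → ℤ} (hk : Tendsto k atTop atTop)
    {f : ∀ n, CuspForm 𝒮ℒ (k n)} (hnorm : ∀ n, L2Normalized (f n)) {c : ℂ} {ρ : ℝ}
    (hsub : closedBall c ρ ⊆ UpperHalfPlane.coe '' ModularGroup.fdo) {ε : ℝ} (hε : 0 < ε) :
    ∀ᶠ n in atTop, ∀ z ∈ closedBall c ρ,
      ‖f n (UpperHalfPlane.ofComplex z)‖ ^ 2 ≤ exp ((k n : ℝ) * (ε - log z.im)) := by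
  have hopen : IsOpen (UpperHalfPlane.coe '' ModularGroup.fdo) :=
    UpperHalfPlane.isOpenEmbedding_coe.isOpenMap _ ModularGroup.isOpen_fdo
  obtain ⟨r₀, hr₀, hthick⟩ :=
    (isCompact_closedBall c ρ).exists_cthickening_subset_open hopen hsub
  have he : exp (-(ε / 2)) < 1 := exp_lt_one_iff.mpr (by linarith)
  set r := min r₀ ((1 - exp (-(ε / 2))) / 2) with hrdef
  have hr : 0 < r := lt_min hr₀ (by linarith)
  -- The radius `r` costs a factor `exp (-(ε / 2))` in the height, hence `exp (k * ε / 2)` in the bound;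
  -- the other half of `ε` absorbs the constant `M`.
  set M := (c.im + ρ) ^ 2 / (3 * r ^ 2) with hM
  have hkR : Tendsto (fun n => (k n : ℝ)) atTop atTop := tendsto_intCast_atTop_atTop.comp hk
  have hexp : Tendsto (fun n => exp ((k n : ℝ) * (ε / 2))) atTop atTop :=
    tendsto_exp_atTop.comp (hkR.atTop_mul_const (by linarith))
  filter_upwards [hk.eventually_ge_atTop 2, hexp.eventually_ge_atTop M] with n hk2 hMn z hz
  have hy : 1 / 2 < z.im := half_lt_im_of_mem_coe_fdo (hsub hz)
  have hy0 : 0 < z.im := by linarith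
  have hyY : z.im ≤ c.im + ρ := by
    rw [mem_closedBall, dist_eq_norm] at hz
    have h1 := Complex.abs_im_le_norm (z - c)
    rw [Complex.sub_im, abs_le] at h1
    linarith
  have hry : z.im * exp (-(ε / 2)) ≤ z.im - r := by
    have h1 : r ≤ (1 - exp (-(ε / 2))) / 2 := min_le_right _ _
    nlinarith
  have hrz : r < z.im := by
    have := mul_pos hy0 (exp_pos (-(ε / 2)))
    linarith
  have hbound := norm_sq_mul_le_one (hnorm n) hk2 hr hrz ((closedBall_subset_cthickening hz r).trans
    ((cthickening_mono (min_le_left _ _) _).trans hthick))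
  set N := ‖f n (UpperHalfPlane.ofComplex z)‖ ^ 2 with hN
  have h1 : exp (((k n : ℝ) - 2) * (log z.im - ε / 2)) ≤ (z.im - r) ^ (k n - 2) := by
    have h2 : exp (((k n : ℝ) - 2) * (log z.im - ε / 2)) =
        (z.im * exp (-(ε / 2))) ^ (k n - 2) := by
      have h3 : z.im * exp (-(ε / 2)) = exp (log z.im - ε / 2) := by
        rw [sub_eq_add_neg, exp_add, exp_log hy0]
      rw [h3, ← exp_intCast_mul]
      push_cast
      rfl
    rw [h2]
    exact zpow_le_zpow_left₀ (by omega) (by positivity) hry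
  have h4 : 3 * r ^ 2 * exp (((k n : ℝ) - 2) * (log z.im - ε / 2)) * N ≤ 1 := by
    refine le_trans ?_ hbound
    gcongr
  have h5 : exp (-2 * log z.im) * (c.im + ρ) ^ 2 ≥ 1 := by
    have h6 : exp (-2 * log z.im) = (z.im ^ 2)⁻¹ := by
      rw [neg_mul, exp_neg, two_mul, exp_add, exp_log hy0, sq]
    rw [h6, ge_iff_le, ← div_eq_inv_mul, one_le_div (by positivity)]
    gcongr
  have h7 : exp (((k n : ℝ) - 2) * (log z.im - ε / 2)) =
      exp (-2 * log z.im) * exp ε * exp (-((k n : ℝ) * (ε / 2 - log z.im))) := by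
    rw [← exp_add, ← exp_add]
    congr 1
    ring
  have h8 : exp ((k n : ℝ) * (ε - log z.im)) =
      exp ((k n : ℝ) * (ε / 2)) * exp ((k n : ℝ) * (ε / 2 - log z.im)) := by
    rw [← exp_add]
    congr 1
    ring
  rw [h7] at h4
  set E := exp ((k n : ℝ) * (ε / 2 - log z.im)) with hE
  have hE0 : 0 < E := exp_pos _
  rw [exp_neg, ← hE] at h4
  have h9 : N ≤ M * E := by
    have h10 : 3 * r ^ 2 * (exp (-2 * log z.im) * exp ε) * N ≤ E := by
      calc _ = 3 * r ^ 2 * (exp (-2 * log z.im) * exp ε * E⁻¹) * N * E := by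
            field_simp
        _ ≤ 1 * E := by gcongr
        _ = E := one_mul E
    have h11 : 1 ≤ exp ε := one_le_exp hε.le
    have hN0 : 0 ≤ N := by positivity
    calc N ≤ (exp (-2 * log z.im) * (c.im + ρ) ^ 2) * exp ε * N := by
          have : 1 ≤ (exp (-2 * log z.im) * (c.im + ρ) ^ 2) * exp ε := by nlinarith
          nlinarith
      _ = (c.im + ρ) ^ 2 / (3 * r ^ 2) * (3 * r ^ 2 * (exp (-2 * log z.im) * exp ε) * N) := by
          field_simp
      _ ≤ M * E := by
          rw [hM]
          gcongr
  rw [h8]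
  exact h9.trans (by gcongr)

/-- The hyperbolic distance from a point of the modular domain to the image of `τ`. -/
noncomputable def distTo (τ : ℍ) : ModularDomain → ℝ :=
  Quotient.lift (fun z : ℍ => infDist z (MulAction.orbit SL(2, ℤ) τ)) (by
    rintro _ z ⟨g, rfl⟩
    have h : MulAction.orbit SL(2, ℤ) τ =
        (fun z : ℍ => g • z) '' MulAction.orbit SL(2, ℤ) τ := by
      rw [image_smul, MulAction.smul_orbit]
    change infDist (g • z) _ = infDist z _
    conv_lhs => rw [h]
    exact infDist_image (isometry_smul ℍ g))

lemma distTo_proj (τ z : ℍ) :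
    distTo τ (proj z) = infDist z (MulAction.orbit SL(2, ℤ) τ) := rfl

lemma continuous_distTo (τ : ℍ) : Continuous (distTo τ) :=
  Continuous.quotient_lift (continuous_infDist_pt _) _

lemma exists_mem_ball_of_distTo_lt {τ : ℍ} {x : ModularDomain} {δ : ℝ} (h : distTo τ x < δ) :
    ∃ z ∈ ball τ δ, proj z = x := by
  obtain ⟨z, rfl⟩ := proj_surjective x
  rw [distTo_proj, infDist_lt_iff ⟨τ, MulAction.mem_orbit_self τ⟩] at h
  obtain ⟨_, ⟨g, rfl⟩, hg⟩ := h
  refine ⟨g⁻¹ • z, ?_, proj_smul _ _⟩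
  have h1 : dist (g⁻¹ • z) τ = dist z (g • τ) := by
    rw [← dist_smul g (g⁻¹ • z) τ, smul_inv_smul]
  rw [mem_ball, h1]
  exact hg

lemma distTo_le_dist (τ z : ℍ) : distTo τ (proj z) ≤ dist z τ :=
  infDist_le_dist_of_mem (MulAction.mem_orbit_self τ)

/-- A tent function on the modular domain, centred at the image of `τ`. -/
noncomputable def tent (τ : ℍ) (δ : ℝ) (x : ModularDomain) : ℝ := max 0 (1 - distTo τ x / δ)

lemma tent_nonneg (τ : ℍ) (δ : ℝ) : 0 ≤ tent τ δ := fun _ => le_max_left _ _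

lemma continuous_tent (τ : ℍ) (δ : ℝ) : Continuous (tent τ δ) := by
  have := continuous_distTo τ
  unfold tent
  fun_prop

lemma tent_eq_zero {τ : ℍ} {δ : ℝ} (hδ : 0 < δ) {x : ModularDomain} (h : δ ≤ distTo τ x) :
    tent τ δ x = 0 := by
  unfold tent
  rw [max_eq_left_iff, sub_nonpos, one_le_div hδ]
  exact h

lemma hasCompactSupport_tent (τ : ℍ) {δ : ℝ} (hδ : 0 < δ) : HasCompactSupport (tent τ δ) := by
  have hclosed : IsClosed {x | distTo τ x ≤ δ} :=
    isClosed_le (continuous_distTo τ) continuous_const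
  have hcomp : IsCompact {x | distTo τ x ≤ δ} := by
    refine ((isCompact_closedBall τ (2 * δ)).image continuous_proj).of_isClosed_subset hclosed ?_
    intro x hx
    obtain ⟨z, hz, rfl⟩ := exists_mem_ball_of_distTo_lt (lt_of_le_of_lt hx
      (show δ < 2 * δ by linarith))
    exact ⟨z, ball_subset_closedBall hz, rfl⟩
  refine HasCompactSupport.intro' hcomp hclosed fun x hx => tent_eq_zero hδ ?_
  exact (not_le.mp hx).le

lemma integrable_tent (τ : ℍ) {δ : ℝ} (hδ : 0 < δ) : Integrable (tent τ δ) dV :=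
  (continuous_tent τ δ).integrable_of_hasCompactSupport (hasCompactSupport_tent τ hδ)

lemma volume_pos_of_isOpen {s : Set ℍ} (hs : IsOpen s) (hne : s.Nonempty) : 0 < volume s := by
  rw [volume_eq_lintegral_ofReal, setLIntegral_pos_iff (by have := Complex.measurable_im; fun_prop)]
  have ho : IsOpen (UpperHalfPlane.coe '' s) := UpperHalfPlane.isOpenEmbedding_coe.isOpenMap _ hs
  refine (ho.measure_pos volume (hne.image _)).trans_le (measure_mono ?_)
  rintro _ ⟨z, hz, rfl⟩
  refine ⟨?_, z, hz, rfl⟩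
  have := z.im_pos
  rw [Function.mem_support, UpperHalfPlane.coe_im]
  exact (ENNReal.ofReal_pos.mpr (by positivity)).ne'

lemma integral_tent_pos {τ : ℍ} (hτ : τ ∈ ModularGroup.fdo) {δ : ℝ} (hδ : 0 < δ) :
    0 < ∫ x, tent τ δ x ∂dV := by
  rw [integral_pos_iff_support_of_nonneg (tent_nonneg τ δ) (integrable_tent τ hδ)]
  have hopen : IsOpen (Function.support (tent τ δ)) := (continuous_tent τ δ).isOpen_support
  rw [dV_apply hopen.measurableSet]
  refine ENNReal.mul_pos (ENNReal.ofReal_pos.mpr (by positivity)).ne' (volume_pos_of_isOpen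
    ((hopen.preimage continuous_proj).inter ModularGroup.isOpen_fdo) ⟨τ, ?_, hτ⟩).ne'
  have h0 : distTo τ (proj τ) ≤ 0 := (distTo_le_dist τ τ).trans (dist_self τ).le
  have h1 : distTo τ (proj τ) / δ ≤ 0 := div_nonpos_of_nonpos_of_nonneg h0 hδ.le
  rw [mem_preimage, Function.mem_support, tent]
  exact (lt_max_of_lt_right (by linarith)).ne'

/-- Weak convergence of the masses forbids the mass from being small throughout a disc. -/
lemma eventually_exists_exp_le_norm_sq {k : ℕ → ℤ} (hk : Tendsto k atTop atTop)
    {f : ∀ n, CuspForm 𝒮ℒ (k n)} {a : ℝ} (ha : 0 < a) (hmass : MassConvergesWeakly f a) {z : ℂ}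
    (hz : z ∈ UpperHalfPlane.coe '' ModularGroup.fdo) {δ : ℝ} (hδ : 0 < δ) {ε : ℝ} (hε : 0 < ε) :
    ∀ᶠ n in atTop, ∃ z' ∈ ball z δ,
      exp ((k n : ℝ) * (-ε - log z'.im)) ≤ ‖f n (UpperHalfPlane.ofComplex z')‖ ^ 2 := by
  obtain ⟨τ, hτ, rfl⟩ := hz
  obtain ⟨δ', hδ', hcont⟩ := Metric.continuousAt_iff.mp
    (UpperHalfPlane.continuous_coe.continuousAt (x := τ)) δ hδ
  have hI := integral_tent_pos hτ hδ'
  have hlim := hmass _ (continuous_tent τ δ') (hasCompactSupport_tent τ hδ')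
  have hev := hlim.eventually_const_lt
    (show a / 2 * ∫ x, tent τ δ' x ∂dV < a * ∫ x, tent τ δ' x ∂dV by gcongr; linarith)
  have hkR : Tendsto (fun n => (k n : ℝ)) atTop atTop := tendsto_intCast_atTop_atTop.comp hk
  have hexp : Tendsto (fun n => exp ((k n : ℝ) * (-ε))) atTop (𝓝 0) :=
    tendsto_exp_atBot.comp (hkR.atTop_mul_const_of_neg (by linarith))
  filter_upwards [hev, hexp.eventually_le_const (show 0 < a / 2 by linarith)] with n hn hexpn
  -- Otherwise the mass would be less than `a / 2` on the support of the tent function, although its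
  -- integral against the tent function tends to `a` times the integral of the latter.
  have hex : ∃ z ∈ ball τ δ', a / 2 ≤ mass (f n) (proj z) := by
    by_contra! hcon
    refine hn.not_ge ?_
    rw [← integral_const_mul]
    refine integral_mono_of_nonneg (ae_of_all _ fun x =>
      mul_nonneg (tent_nonneg _ _ _) (mass_nonneg _ _)) ((integrable_tent τ hδ').const_mul _)
      (ae_of_all _ fun x => ?_)
    change tent τ δ' x * mass (f n) x ≤ a / 2 * tent τ δ' x
    rcases lt_or_ge (distTo τ x) δ' with h | h
    · obtain ⟨w, hw, rfl⟩ := exists_mem_ball_of_distTo_lt h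
      have h1 := (hcon w hw).le
      rw [mul_comm]
      exact mul_le_mul_of_nonneg_right h1 (tent_nonneg _ _ _)
    · rw [tent_eq_zero hδ' h]
      simp
  obtain ⟨w, hw, hmw⟩ := hex
  refine ⟨w, hcont hw, ?_⟩
  rw [UpperHalfPlane.ofComplex_apply, UpperHalfPlane.coe_im]
  rw [mass_proj] at hmw
  have h1 : exp ((k n : ℝ) * (-ε - log w.im)) = exp ((k n : ℝ) * (-ε)) / w.im ^ (k n) := by
    rw [mul_sub, exp_sub, exp_intCast_mul (log w.im), exp_log w.im_pos]
  rw [h1, div_le_iff₀ (zpow_pos w.im_pos _)]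
  linarith

/-- The cusp forms `f n` are asymptotically extremal in the interior of the fundamental domain. -/
lemma asymptoticallyExtremal_cuspForm {k : ℕ → ℤ} (hk : Tendsto k atTop atTop)
    {f : ∀ n, CuspForm 𝒮ℒ (k n)} (hnorm : ∀ n, L2Normalized (f n)) {a : ℝ} (ha : 0 < a)
    (hmass : MassConvergesWeakly f a) :
    AsymptoticallyExtremal (UpperHalfPlane.coe '' ModularGroup.fdo) (fun n => (k n : ℝ))
      (fun n s => f n (UpperHalfPlane.ofComplex s)) where
  half_lt_im _ hz := half_lt_im_of_mem_coe_fdo hz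
  tendsto_weight := tendsto_intCast_atTop_atTop.comp hk
  measurable n := measurable_comp_ofComplex (f n)
  analytic n _ hz := analyticAt_comp_ofComplex (f n) (by linarith [half_lt_im_of_mem_coe_fdo hz])
  upper _ _ hsub _ hε := eventually_norm_sq_le_exp hk hnorm hsub hε
  lower _ hz _ hδ _ hε := eventually_exists_exp_le_norm_sq hk ha hmass hz hδ hε

/-! ### Zeros in open sets -/

lemma lintegral_closedBall_inv_im_sq_le {c : ℂ} {R q : ℝ} (hR : 0 ≤ R) (hq : 0 < q)
    (hc : 0 < c.im) (hRc : R ≤ (1 - q) * c.im) :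
    ∫⁻ z in closedBall c R, ENNReal.ofReal (3 / (π * z.im ^ 2)) ≤
      ENNReal.ofReal (3 * R ^ 2 / (q ^ 2 * c.im ^ 2)) := by
  calc ∫⁻ z in closedBall c R, ENNReal.ofReal (3 / (π * z.im ^ 2))
      ≤ ∫⁻ _ in closedBall c R, ENNReal.ofReal (3 / (π * (q * c.im) ^ 2)) := by
        refine setLIntegral_mono measurable_const fun z hz => ENNReal.ofReal_le_ofReal ?_
        rw [mem_closedBall, dist_eq_norm] at hz
        have h1 := Complex.abs_im_le_norm (z - c)
        rw [Complex.sub_im, abs_le] at h1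
        have h2 : q * c.im ≤ z.im := by linarith
        gcongr
    _ = ENNReal.ofReal (3 * R ^ 2 / (q ^ 2 * c.im ^ 2)) := by
        rw [setLIntegral_const, Complex.volume_closedBall, ← ENNReal.ofReal_pow hR,
          ← ENNReal.ofReal_coe_nnreal, ← ENNReal.ofReal_mul (by positivity),
          ← ENNReal.ofReal_mul (by positivity), NNReal.coe_real_pi]
        congr 1
        field_simp

/-- Lower bound for the number of zeros in an open set: exhaust it, up to a null set, by disjoint
discs that are small compared with their height. -/
lemma AsymptoticallyExtremal.eventually_le_sum_order_of_isOpen {U : Set ℂ} {k : ℕ → ℝ}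
    {g : ℕ → ℂ → ℂ} (h : AsymptoticallyExtremal U k g) {W : Set ℂ} (hW : IsOpen W) (hWU : W ⊆ U)
    {t : ℝ} (ht : ENNReal.ofReal t < ∫⁻ z in W, ENNReal.ofReal (3 / (π * z.im ^ 2))) :
    ∀ᶠ n in atTop, ∃ T : Finset ℂ, (T : Set ℂ) ⊆ W ∧
      t ≤ 12 / k n * ∑ u ∈ T, (analyticOrderNatAt (g n) u : ℝ) := by
  classical
  obtain ⟨a, ha0, hta, haW⟩ := ENNReal.lt_iff_exists_real_btwn.mp ht
  rw [ENNReal.ofReal_lt_ofReal_iff'] at hta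
  obtain ⟨hta, ha⟩ := hta
  -- A factor `q ^ 2` is lost to the variation of `y` over a disc and another one to the ratio of the
  -- radii in the lower bound for the zeros in a disc.
  obtain ⟨q, hqt, hq0, hq1⟩ : ∃ q : ℝ, t < q ^ 4 * a ∧ 0 < q ∧ q < 1 := by
    have hc : Tendsto (fun q : ℝ => q ^ 4 * a) (𝓝[<] 1) (𝓝 (1 ^ 4 * a)) :=
      (Continuous.tendsto (by fun_prop) 1).mono_left nhdsWithin_le_nhds
    rw [one_pow, one_mul] at hc
    have h0 : ∀ᶠ q : ℝ in 𝓝[<] 1, 0 < q :=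
      nhdsWithin_le_nhds (lt_mem_nhds one_pos)
    obtain ⟨q, h1, h2, h3⟩ :=
      ((hc.eventually_const_lt hta).and (h0.and self_mem_nhdsWithin)).exists
    exact ⟨q, h1, h2, h3⟩
  set κ : Measure ℂ := volume.withDensity fun z => ENNReal.ofReal (3 / (π * z.im ^ 2)) with hκ
  have hκapp {s : Set ℂ} (hs : MeasurableSet s) :
      κ s = ∫⁻ z in s, ENNReal.ofReal (3 / (π * z.im ^ 2)) := withDensity_apply _ hs
  have him {z : ℂ} (hz : z ∈ W) : 1 / 2 < z.im := h.half_lt_im z (hWU hz)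
  obtain ⟨s, R, hsc, hsW, hR, hcover, hdisj⟩ :=
    Besicovitch.exists_disjoint_closedBall_covering_ae (volume : Measure ℂ)
      (fun z => {ρ : ℝ | closedBall z (3 * ρ) ⊆ W ∧ ρ ≤ (1 - q) * z.im}) W (by
        intro z hz δ hδ
        obtain ⟨r, hr, hrW⟩ := Metric.nhds_basis_closedBall.mem_iff.mp (hW.mem_nhds hz)
        have hz2 := him hz
        have hq : 0 < (1 - q) * z.im := mul_pos (by linarith) (by linarith)
        refine ⟨min (r / 3) (min ((1 - q) * z.im) (δ / 2)), ⟨?_, ?_⟩, ?_, ?_⟩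
        · refine (closedBall_subset_closedBall ?_).trans hrW
          linarith [min_le_left (r / 3) (min ((1 - q) * z.im) (δ / 2))]
        · exact (min_le_right _ _).trans (min_le_left _ _)
        · exact lt_min (by linarith) (lt_min hq (by linarith))
        · exact ((min_le_right _ _).trans (min_le_right _ _)).trans_lt (by linarith))
      (fun _ => 1) (fun _ _ => one_pos)
  have hκW : κ W ≤ ∑' z : s, κ (closedBall z (R z)) := by
    have hnull : κ (W \ ⋃ z ∈ s, closedBall z (R z)) = 0 :=
      withDensity_absolutelyContinuous _ _ hcover
    calc κ W ≤ κ (⋃ z ∈ s, closedBall z (R z)) := measure_mono_ae (ae_le_set.mpr hnull)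
      _ ≤ _ := measure_biUnion_le κ hsc _
  rw [← hκapp hW.measurableSet] at haW
  -- Finitely many of the discs suffice, so that the lower bounds hold for all of them at once.
  obtain ⟨F, hF⟩ := lt_iSup_iff.mp (haW.trans_le (hκW.trans_eq ENNReal.tsum_eq_iSup_sum))
  have hRpos (z : s) : 0 < R z := (hR z z.2).2.1
  have hball (z : s) : κ (closedBall z (R z)) ≤
      ENNReal.ofReal (3 * R z ^ 2 / (q ^ 2 * (z : ℂ).im ^ 2)) := by
    rw [hκapp measurableSet_closedBall]
    exact lintegral_closedBall_inv_im_sq_le (hRpos z).le hq0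
      (by linarith [him (hsW z.2)]) (hR z z.2).1.2
  have hsum : a < ∑ z ∈ F, 3 * R z ^ 2 / (q ^ 2 * (z : ℂ).im ^ 2) := by
    have h1 := hF.trans_le (Finset.sum_le_sum fun z _ => hball z)
    rw [← ENNReal.ofReal_sum_of_nonneg (fun z _ => by positivity),
      ENNReal.ofReal_lt_ofReal_iff'] at h1
    exact h1.1
  set η := (q ^ 4 * a - t) / (F.card + 1) with hη
  have hη0 : 0 < η := div_pos (by linarith) (by positivity)
  have hdisc : ∀ᶠ n in atTop, ∀ z ∈ F, ∃ T : Finset ℂ, (T : Set ℂ) ⊆ ball (z : ℂ) (R z) ∧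
      3 * (q * R z) ^ 2 / (z : ℂ).im ^ 2 - η ≤
        12 / k n * ∑ u ∈ T, (analyticOrderNatAt (g n) u : ℝ) := by
    refine (Finset.eventually_all F).mpr fun z _ => ?_
    have hz := him (hsW z.2)
    refine h.eventually_le_sum_order (mul_pos hq0 (hRpos z)) ?_ ?_
      ((hR z z.2).1.1.trans hWU) hη0
    · nlinarith [hRpos z]
    · have := (hR z z.2).1.2
      nlinarith
  filter_upwards [hdisc] with n hn
  choose! T hTsub hT using hn
  refine ⟨F.biUnion T, ?_, ?_⟩
  · intro u hu
    obtain ⟨z, hz, huz⟩ := Finset.mem_biUnion.mp hu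
    refine (hR z z.2).1.1 (closedBall_subset_closedBall ?_
      (ball_subset_closedBall (hTsub z hz huz)))
    linarith [hRpos z]
  · have hpd : (F : Set s).PairwiseDisjoint T := by
      intro z hz z' hz' hne
      rw [Function.onFun, ← Finset.disjoint_coe]
      exact (hdisj z.2 z'.2 (Subtype.coe_injective.ne hne)).mono
        ((hTsub z hz).trans ball_subset_closedBall) ((hTsub z' hz').trans ball_subset_closedBall)
    rw [Finset.sum_biUnion hpd, Finset.mul_sum]
    refine le_trans ?_ (Finset.sum_le_sum hT)
    rw [Finset.sum_sub_distrib, Finset.sum_const, nsmul_eq_mul]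
    have h1 : ∑ z ∈ F, 3 * (q * R z) ^ 2 / (z : ℂ).im ^ 2 =
        q ^ 4 * ∑ z ∈ F, 3 * R z ^ 2 / (q ^ 2 * (z : ℂ).im ^ 2) := by
      rw [Finset.mul_sum]
      refine Finset.sum_congr rfl fun z _ => ?_
      have := him (hsW z.2)
      have h0 : (z : ℂ).im ≠ 0 := by linarith
      field_simp
    have h2 : F.card * η ≤ q ^ 4 * a - t := by
      rw [hη, mul_div_assoc', div_le_iff₀ (by positivity)]
      nlinarith
    rw [h1]
    have h3 : q ^ 4 * a ≤ q ^ 4 * ∑ z ∈ F, 3 * R z ^ 2 / (q ^ 2 * (z : ℂ).im ^ 2) := by gcongr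
    linarith

/-! ### The normalized zero counting measures -/

lemma ord_proj {k : ℤ} (f : CuspForm 𝒮ℒ k) (z : ℍ) : ord f (proj z) = ordAt f z := rfl

lemma w_nonneg (x : ModularDomain) : 0 ≤ w x := by
  obtain ⟨z, rfl⟩ := proj_surjective x
  change (0 : ℝ) ≤ 1 / (Nat.card (stab z) : ℝ)
  positivity

lemma w_proj_of_mem_fdo {z : ℍ} (hz : z ∈ ModularGroup.fdo) : w (proj z) = 1 := by
  have h : stab z = ⊥ := by
    rw [eq_bot_iff]
    rintro _ ⟨g, hg, rfl⟩
    have hgz : g • z = z := hg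
    rw [Subgroup.mem_bot, QuotientGroup.mk'_apply, QuotientGroup.eq_one_iff,
      Subgroup.mem_center_iff]
    rcases ModularGroup.eq_one_or_neg_one_of_mem_fdo_mem_fdo hz (hgz.symm ▸ hz) with rfl | rfl <;>
      simp
  change 1 / (Nat.card (stab z) : ℝ) = 1
  simp [h]

lemma weight_nonneg {k : ℤ} (f : CuspForm 𝒮ℒ k) (x : ModularDomain) : 0 ≤ w x * ord f x :=
  mul_nonneg (w_nonneg x) (Nat.cast_nonneg _)

lemma finite_support_of_ν_pos {k : ℤ} {f : CuspForm 𝒮ℒ k} (hν : 0 < ν f) :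
    (Function.support fun x => w x * ord f x).Finite := by
  by_contra h
  exact hν.ne' (finsum_of_infinite_support h)

open Classical in
/-- The probability measure `(1 / ν(f)) ∑ w(x) ord_x(f) δ_x` on the modular domain. If `ν(f)` is not
positive, which happens for finitely many forms of the sequence only, the value is the dummy `dV`. -/
noncomputable def zeroMeasure {k : ℤ} (f : CuspForm 𝒮ℒ k) : Measure ModularDomain :=
  if h : 0 < ν f then
    ∑ x ∈ (finite_support_of_ν_pos h).toFinset,
      ENNReal.ofReal (w x * ord f x / ν f) • Measure.dirac x
  else dV

lemma zeroMeasure_apply {k : ℤ} {f : CuspForm 𝒮ℒ k} (hν : 0 < ν f) (s : Set ModularDomain) :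
    zeroMeasure f s = ENNReal.ofReal (1 / ν f * ∑ᶠ x ∈ s, w x * ord f x) := by
  classical
  rw [finsum_mem_def, finsum_eq_sum_of_support_subset
    (s := (finite_support_of_ν_pos hν).toFinset), Finset.mul_sum, ENNReal.ofReal_sum_of_nonneg,
    zeroMeasure, dif_pos hν, Measure.finsetSum_apply]
  · refine Finset.sum_congr rfl fun x _ => ?_
    rw [Measure.smul_apply, Measure.dirac_apply, smul_eq_mul]
    by_cases hx : x ∈ s
    · rw [indicator_of_mem hx, indicator_of_mem hx, Pi.one_apply, mul_one, one_div,
        div_eq_inv_mul]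
    · rw [indicator_of_notMem hx, indicator_of_notMem hx]
      simp
  · exact fun x _ => mul_nonneg (by positivity)
      (indicator_nonneg (fun x _ => weight_nonneg f x) x)
  · rw [Finite.coe_toFinset, support_indicator]
    exact inter_subset_right

instance {k : ℤ} (f : CuspForm 𝒮ℒ k) : IsProbabilityMeasure (zeroMeasure f) := by
  by_cases hν : 0 < ν f
  · refine ⟨?_⟩
    rw [zeroMeasure_apply hν, finsum_mem_univ]
    change ENNReal.ofReal (1 / ν f * ν f) = 1
    rw [one_div_mul_cancel hν.ne', ENNReal.ofReal_one]
  · rw [zeroMeasure, dif_neg hν]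
    infer_instance

lemma integral_zeroMeasure {k : ℤ} {f : CuspForm 𝒮ℒ k} (hν : 0 < ν f) (F : ModularDomain → ℝ) :
    ∫ x, F x ∂(zeroMeasure f) = 1 / ν f * ∑ᶠ x, w x * ord f x * F x := by
  classical
  rw [zeroMeasure, dif_pos hν, integral_finsetSum_measure, finsum_eq_sum_of_support_subset
    (s := (finite_support_of_ν_pos hν).toFinset), Finset.mul_sum]
  · refine Finset.sum_congr rfl fun x _ => ?_
    rw [integral_smul_measure, integral_dirac, ENNReal.toReal_ofReal
      (div_nonneg (weight_nonneg f x) hν.le), smul_eq_mul]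
    ring
  · rw [Finite.coe_toFinset]
    exact Function.support_mul_subset_left _ _
  · exact fun x _ => (integrable_dirac (by simp)).smul_measure ENNReal.ofReal_ne_top

/-- Points of the open fundamental domain are inequivalent and have weight one, so that their
zeros count in full. -/
lemma sum_order_le_finsum {k : ℤ} {f : CuspForm 𝒮ℒ k} (hν : 0 < ν f) {G : Set ModularDomain}
    {T : Finset ℂ}
    (hT : (T : Set ℂ) ⊆ UpperHalfPlane.coe '' (proj ⁻¹' G ∩ ModularGroup.fdo)) :
    ∑ u ∈ T, (analyticOrderNatAt (fun s => f (UpperHalfPlane.ofComplex s)) u : ℝ) ≤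
      ∑ᶠ x ∈ G, w x * ord f x := by
  classical
  set p : ℂ → ModularDomain := fun u => proj (UpperHalfPlane.ofComplex u) with hp
  have hinj : InjOn p T := by
    intro u hu v hv huv
    obtain ⟨z, hz, rfl⟩ := hT hu
    obtain ⟨z', hz', rfl⟩ := hT hv
    simp only [hp, UpperHalfPlane.ofComplex_apply] at huv
    obtain ⟨g, rfl⟩ := proj_eq_iff.mp huv
    rw [← ModularGroup.eq_smul_self_of_mem_fdo_mem_fdo hz'.2 hz.2]
  have hterm : ∀ u ∈ T, (analyticOrderNatAt (fun s => f (UpperHalfPlane.ofComplex s)) u : ℝ) =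
      G.indicator (fun x => w x * ord f x) (p u) := by
    intro u hu
    obtain ⟨z, hz, rfl⟩ := hT hu
    simp only [hp, UpperHalfPlane.ofComplex_apply]
    rw [indicator_of_mem (show proj z ∈ G from hz.1), w_proj_of_mem_fdo hz.2, one_mul, ord_proj, ordAt]
  rw [Finset.sum_congr rfl hterm, ← Finset.sum_image (f := G.indicator fun x => w x * ord f x) hinj,
    finsum_mem_def, finsum_eq_sum_of_support_subset
      (s := (finite_support_of_ν_pos hν).toFinset ∪ T.image p)]
  · exact Finset.sum_le_sum_of_subset_of_nonneg Finset.subset_union_right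
      fun x _ _ => indicator_nonneg (fun x _ => weight_nonneg f x) x
  · rw [support_indicator, Finset.coe_union, Finite.coe_toFinset]
    exact inter_subset_right.trans subset_union_left

lemma dV_eq_lintegral {G : Set ModularDomain} (hG : MeasurableSet G) :
    dV G = ∫⁻ z in UpperHalfPlane.coe '' (proj ⁻¹' G ∩ ModularGroup.fdo),
      ENNReal.ofReal (3 / (π * z.im ^ 2)) := by
  rw [dV_apply hG, volume_eq_lintegral_ofReal, ← lintegral_const_mul _ (by
    have := Complex.measurable_im
    fun_prop)]
  refine lintegral_congr fun z => ?_
  rw [← ENNReal.ofReal_mul (by positivity)]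
  congr 1
  field_simp

/-- No mass is lost in open sets when the zero counting measures converge. Since all the measures
are probability measures, this one-sided bound is equivalent to weak convergence. -/
lemma dV_le_liminf_zeroMeasure {k : ℕ → ℤ} (hk : Tendsto k atTop atTop)
    {f : ∀ n, CuspForm 𝒮ℒ (k n)} (hnorm : ∀ n, L2Normalized (f n))
    (hν : (fun n => ν (f n)) ~[atTop] fun n => (k n : ℝ) / 12) {a : ℝ} (ha : 0 < a)
    (hmass : MassConvergesWeakly f a) {G : Set ModularDomain} (hG : IsOpen G) :
    dV G ≤ liminf (fun n => zeroMeasure (f n) G) atTop := by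
  have hkR : Tendsto (fun n => (k n : ℝ)) atTop atTop := tendsto_intCast_atTop_atTop.comp hk
  have hk0 := hkR.eventually_gt_atTop 0
  have hext := asymptoticallyExtremal_cuspForm hk hnorm ha hmass
  have hνpos : ∀ᶠ n in atTop, 0 < ν (f n) :=
    (hν.symm.tendsto_atTop (hkR.atTop_div_const (by norm_num))).eventually_gt_atTop 0
  have hratio : Tendsto (fun n => (k n : ℝ) / 12 / ν (f n)) atTop (𝓝 1) := by
    refine (isEquivalent_iff_tendsto_one ?_).mp hν.symm
    filter_upwards [hνpos] with n hn using hn.ne'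
  -- The room between `b` and `b'` absorbs the ratio `(k n / 12) / ν (f n) → 1`.
  refine le_of_forall_lt fun t ht => ?_
  obtain ⟨t₀, htt₀, ht₀⟩ := exists_between ht
  refine htt₀.trans_le ?_
  obtain ⟨b, hb, htb, hbG⟩ := ENNReal.lt_iff_exists_real_btwn.mp ht₀
  obtain ⟨b', hb', hbb', hbG'⟩ := ENNReal.lt_iff_exists_real_btwn.mp hbG
  have hlt : b < b' := (ENNReal.ofReal_lt_ofReal_iff'.mp hbb').1
  have hWo : IsOpen (UpperHalfPlane.coe '' (proj ⁻¹' G ∩ ModularGroup.fdo)) :=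
    UpperHalfPlane.isOpenEmbedding_coe.isOpenMap _
      ((hG.preimage continuous_proj).inter ModularGroup.isOpen_fdo)
  rw [dV_eq_lintegral hG.measurableSet] at hbG'
  have hev := hext.eventually_le_sum_order_of_isOpen hWo (image_mono inter_subset_right) hbG'
  have hev2 := (hratio.const_mul b').eventually_const_lt (show b < b' * 1 by linarith)
  refine le_liminf_of_le (by isBoundedDefault) ?_
  filter_upwards [hev, hev2, hνpos, hk0] with n ⟨T, hTW, hT⟩ hn2 hνn hkn
  rw [zeroMeasure_apply hνn]
  refine htb.le.trans (ENNReal.ofReal_le_ofReal ?_)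
  calc b ≤ b' * ((k n : ℝ) / 12 / ν (f n)) := hn2.le
    _ ≤ (12 / k n * ∑ u ∈ T, (analyticOrderNatAt
          (fun s => f n (UpperHalfPlane.ofComplex s)) u : ℝ)) * ((k n : ℝ) / 12 / ν (f n)) := by
        gcongr
    _ = 1 / ν (f n) * ∑ u ∈ T, (analyticOrderNatAt
          (fun s => f n (UpperHalfPlane.ofComplex s)) u : ℝ) := by
        field_simp
    _ ≤ _ := by
        gcongr
        exact sum_order_le_finsum hνn hTW

end ModularZeros

theorem theorem2 (k : ℕ → ℤ) (hk : Tendsto k atTop atTop)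
    (f : ∀ n, CuspForm 𝒮ℒ (k n))
    (hnorm : ∀ n, ModularZeros.L2Normalized (f n))
    (hν : (fun n => ModularZeros.ν (f n)) ~[atTop] (fun n => (k n : ℝ) / 12))
    (c : ℝ) (hc : 0 < c) (hmass : ModularZeros.MassConvergesWeakly f c) :
    ModularZeros.ZerosEquidistributed f := by
  open ModularZeros in
  have hνpos : ∀ᶠ n in atTop, 0 < ν (f n) :=
    (hν.symm.tendsto_atTop ((tendsto_intCast_atTop_atTop.comp hk).atTop_div_const
      (by norm_num))).eventually_gt_atTop 0
  have hopen (G : Set ModularDomain) (hG : IsOpen G) :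
      dV G ≤ liminf (fun n => zeroMeasure (f n) G) atTop :=
    dV_le_liminf_zeroMeasure hk hnorm hν hc hmass hG
  refine ⟨fun Ω _ hΩ => ?_, fun F hF hFc => ?_⟩
  · have h := (ENNReal.tendsto_toReal (measure_ne_top dV Ω)).comp
      (tendsto_measure_of_null_frontier hopen hΩ)
    refine h.congr' ?_
    filter_upwards [hνpos] with n hn
    rw [Function.comp_apply, zeroMeasure_apply hn, ENNReal.toReal_ofReal]
    exact mul_nonneg (by positivity) (finsum_nonneg fun x => finsum_nonneg fun _ => weight_nonneg (f n) x)
  · obtain ⟨C, hC⟩ := hFc.exists_bound_of_continuous hF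
    have h := ProbabilityMeasure.tendsto_iff_forall_integral_tendsto.mp
      (tendsto_of_forall_isOpen_le_liminf_nat' (μ := ⟨dV, inferInstance⟩)
        (μs := fun n => ⟨zeroMeasure (f n), inferInstance⟩) hopen)
      (BoundedContinuousFunction.ofNormedAddCommGroup F hF C hC)
    refine h.congr' ?_
    filter_upwards [hνpos] with n hn
    exact integral_zeroMeasure hn F
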